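/- Let $(M,\bar g,I,J,K)$ be a hyperk\"ahler 4-manifold: a smooth 4-manifold with a Riemannian metric $\bar g$ and almost complex structures $I,J,K$ that are $\bar g$-orthogonal, parallel for the Levi-Civita connection $\overline\nabla$ of $\bar g$, and satisfy $I^2=J^2=K^2=-1$, $IJ=K$. Put $\bar\omega_1=\bar g(I\cdot,\cdot)$, $\bar\omega_2=\bar g(J\cdot,\cdot)$, $\bar\omega_3=\bar g(K\cdot,\cdot)$. Let $S$ be a smooth surface with a volume form $\rho$ (a nowhere vanishing smooth 2-form, which also orients $S$). For an immersion $f:S\to M$ let $N_a=f^*\bar\omega_a/\rho$ and let $\xi_a$ be the Hamiltonian vector field on $S$ with $\rho(\xi_a,\cdot)=dN_a$, $a=1,2,3$. Let $g=f^*\bar g$ be the induced metric, with Levi-Civita connection $\nabla$ and Laplacian $\triangle=g^{ij}\nabla_i\nabla_j$, let $d\mu$ be its area form for the orientation given by $\rho$, and let $\lambda=d\mu/\rho>0$. For an orthonormal frame $\{e_3,e_4\}$ of the normal bundle write $h_{\alpha ij}=\bar g(e_\alpha,\overline\nabla_{\partial_i}\partial_j)$, $H_\alpha=g^{ij}h_{\alpha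 ij}$, and let $H=H_\alpha e_\alpha$ be the mean curvature vector, $|H|^2=\bar g(H,H)$ (repeated indices are summed). Let $f_t$, with $t$ in a nondegenerate interval $\tau$ with least element $0$ (such as $[0,T]$, $[0,T)$ or $[0,\infty)$), be a smooth family of immersions $S\to M$ that solves the H-flow $$\frac{\partial f}{\partial t}=I f_*(\xi_1)+J f_*(\xi_2)+K f_*(\xi_3).$$ Then for all $t\in\tau$, at every point of $S$ (time derivatives being one-sided at an endpoint of $\tau$): (i) $\displaystyle\frac{\partial}{\partial t}g_{kl}=\nabla_k\nabla_l(\lambda^2)-2\lambda^2H_\alpha h_{\alpha kl}$; (ii) $\displaystyle\frac{\partial}{\partial t}d\mu=\left(\triangle\Big(\frac{\lambda^2}{2}\Big)-\lambda^2|H|^2\right)d\mu$; (iii) $\displaystyle\frac{\partial}{\partial t}\lambda^2=\lambda^2\triangle\lambda^2-2(\lambda^2)^2|H|^2$. If moreover $S$ is compact, then $\lambda(x,t)\le\sup_S\lambda|_{t=0}$ for all $t\in\tau$ and $x\in S$. -/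

import Mathlib

open Set Manifold Bundle
open scoped ContDiff

noncomputable section

namespace HFlow

/-- The model space `ℝⁿ`. For a manifold `N` modelled on it, every tangent space `T_qN` is by
definition a copy of `ℝⁿ`, the identification being the one given by the preferred chart at `q`;
so `basisVec n i`, seen in `T_qN`, is the `i`-th coordinate vector `∂_i` of that chart at `q`. -/
abbrev Euc (n : ℕ) : Type := EuclideanSpace ℝ (Fin n)

/-- The `i`-th standard basis vector. -/
def basisVec (n : ℕ) (i : Fin n) : Euc n := EuclideanSpace.single i 1

/-- The matrix `B_{ij} = B(∂_i, ∂_j)` of a bilinear form. -/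
def gram {n : ℕ} (B : Euc n →L[ℝ] Euc n →L[ℝ] ℝ) : Matrix (Fin n) (Fin n) ℝ :=
  Matrix.of fun i j => B (basisVec n i) (basisVec n j)

/-- The trace `B^{ij} T(∂_i, ∂_j)` of a bilinear `T` with respect to the inner product `B`. -/
def metricTrace {n : ℕ} {V : Type*} [AddCommGroup V] [Module ℝ V]
    (B : Euc n →L[ℝ] Euc n →L[ℝ] ℝ) (T : Euc n → Euc n → V) : V :=
  ∑ i, ∑ j, ((gram B)⁻¹ i j) • T (basisVec n i) (basisVec n j)

/-- The pullback `(v,w) ↦ B(Dv, Dw)` of a bilinear form under a linear map. -/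
def pullForm {m n : ℕ} (B : Euc m →L[ℝ] Euc m →L[ℝ] ℝ) (D : Euc n →L[ℝ] Euc m) :
    Euc n →L[ℝ] Euc n →L[ℝ] ℝ :=
  B.bilinearComp D D

section Connection

variable {n : ℕ} {N : Type*} [TopologicalSpace N] [ChartedSpace (Euc n) N]
  [IsManifold (𝓡 n) ∞ N]

/-- A bilinear form in the chart at `q`: at the point `y` of the chart domain this has components
`b_{ij}(y) = b(∂_i, ∂_j)`. Here `symmL` of the trivialization of the tangent bundle at `q` is the
differential of the inverse of the chart at `q`. -/
def chartForm (b : ∀ x : N, TangentSpace (𝓡 n) x →L[ℝ] TangentSpace (𝓡 n) x →L[ℝ] ℝ)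
    (q : N) (y : Euc n) : Euc n →L[ℝ] Euc n →L[ℝ] ℝ :=
  let x := (extChartAt (𝓡 n) q).symm y
  let D := (trivializationAt (Euc n) (TangentSpace (𝓡 n)) q).symmL ℝ x
  pullForm (b x) D

/-- A field of endomorphisms of the tangent spaces in the chart at `q`. -/
def chartEnd (A : ∀ x : N, TangentSpace (𝓡 n) x →L[ℝ] TangentSpace (𝓡 n) x)
    (q : N) (y : Euc n) : Euc n →L[ℝ] Euc n :=
  let x := (extChartAt (𝓡 n) q).symm y
  let e := trivializationAt (Euc n) (TangentSpace (𝓡 n)) q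
  (e.continuousLinearMapAt ℝ x).comp ((A x).comp (e.symmL ℝ x))

/-- Christoffel symbols of the first kind of the metric `g`, at `q` in the chart at `q`:
`½ (∂_v g(w,z) + ∂_w g(v,z) - ∂_z g(v,w))`. -/
def christoffelLow (g : ∀ x : N, TangentSpace (𝓡 n) x →L[ℝ] TangentSpace (𝓡 n) x →L[ℝ] ℝ)
    (q : N) (v w z : Euc n) : ℝ :=
  let dG := fderiv ℝ (chartForm g q) (extChartAt (𝓡 n) q q)
  (1 / 2) * (dG v w z + dG w v z - dG z v w)

/-- Christoffel symbols (of the second kind) of the Levi-Civita connection of `g`, at `q` in the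
chart at `q`: the vector `Γ(v,w) = g^{ij} Γ_{i}(v,w) ∂_j`. -/
def christoffel (g : ∀ x : N, TangentSpace (𝓡 n) x →L[ℝ] TangentSpace (𝓡 n) x →L[ℝ] ℝ)
    (q : N) (v w : Euc n) : Euc n :=
  metricTrace (g q) fun a b => christoffelLow g q v w a • b

/-- The covariant derivative `(∇_v A) w` at `q` of a field of endomorphisms, for the Levi-Civita
connection of `g`. -/
def covDerivEnd (g : ∀ x : N, TangentSpace (𝓡 n) x →L[ℝ] TangentSpace (𝓡 n) x →L[ℝ] ℝ)
    (A : ∀ x : N, TangentSpace (𝓡 n) x →L[ℝ] TangentSpace (𝓡 n) x)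
    (q : N) (v w : Euc n) : Euc n :=
  let Aq : Euc n →L[ℝ] Euc n := A q
  fderiv ℝ (chartEnd A q) (extChartAt (𝓡 n) q q) v w
    + christoffel g q v (Aq w) - Aq (christoffel g q v w)

/-- The Hessian `∇_v ∇_w u` at `p` of a function, for the Levi-Civita connection of `g`:
`∂_v ∂_w u - du(Γ(v,w))` in the chart at `p`. -/
def hess (g : ∀ x : N, TangentSpace (𝓡 n) x →L[ℝ] TangentSpace (𝓡 n) x →L[ℝ] ℝ)
    (u : N → ℝ) (p : N) (v w : Euc n) : ℝ :=
  let U := u ∘ (extChartAt (𝓡 n) p).symm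
  let y := extChartAt (𝓡 n) p p
  fderiv ℝ (fderiv ℝ U) y v w - fderiv ℝ U y (christoffel g p v w)

/-- The Laplace-Beltrami operator `Δu = g^{ij} ∇_i ∇_j u`. -/
def laplacian (g : ∀ x : N, TangentSpace (𝓡 n) x →L[ℝ] TangentSpace (𝓡 n) x →L[ℝ] ℝ)
    (u : N → ℝ) (p : N) : ℝ :=
  metricTrace (g p) (hess g u p)

end Connection

/-- A hyperkähler structure on a 4-manifold: a smooth Riemannian metric and three smooth almost
complex structures `I = cplx 0`, `J = cplx 1`, `K = cplx 2` satisfying the quaternion relations,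
orthogonal for the metric and parallel for its Levi-Civita connection. -/
structure HyperKahler (M : Type*) [TopologicalSpace M] [ChartedSpace (Euc 4) M]
    [IsManifold (𝓡 4) ∞ M] where
  /-- the metric -/
  metric : ContMDiffRiemannianMetric (𝓡 4) ∞ (Euc 4) (fun x : M => TangentSpace (𝓡 4) x)
  /-- the complex structures `I`, `J`, `K` -/
  cplx : Fin 3 → ∀ x : M, TangentSpace (𝓡 4) x →L[ℝ] TangentSpace (𝓡 4) x
  smooth : ∀ a, ContMDiff (𝓡 4) ((𝓡 4).prod 𝓘(ℝ, Euc 4 →L[ℝ] Euc 4)) ∞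
    (fun x => TotalSpace.mk' (Euc 4 →L[ℝ] Euc 4)
      (E := fun x : M => TangentSpace (𝓡 4) x →L[ℝ] TangentSpace (𝓡 4) x) x (cplx a x))
  sq : ∀ a x v, cplx a x (cplx a x v) = -v
  quat : ∀ x v, cplx 0 x (cplx 1 x v) = cplx 2 x v
  orthogonal : ∀ a x v w, metric.inner x (cplx a x v) (cplx a x w) = metric.inner x v w
  parallel : ∀ a x v w, covDerivEnd metric.inner (cplx a) x v w = 0

/-- A volume (area) form on a surface: a smooth nowhere vanishing 2-form. It also fixes the
orientation of the surface. -/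
structure AreaForm (S : Type*) [TopologicalSpace S] [ChartedSpace (Euc 2) S]
    [IsManifold (𝓡 2) ∞ S] where
  /-- the 2-form -/
  form : ∀ x : S, TangentSpace (𝓡 2) x →L[ℝ] TangentSpace (𝓡 2) x →L[ℝ] ℝ
  alternating : ∀ x v, form x v v = 0
  nonvanishing : ∀ x, form x ≠ 0
  smooth : ContMDiff (𝓡 2) ((𝓡 2).prod 𝓘(ℝ, Euc 2 →L[ℝ] Euc 2 →L[ℝ] ℝ)) ∞
    (fun x => TotalSpace.mk' (Euc 2 →L[ℝ] Euc 2 →L[ℝ] ℝ)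
      (E := fun x : S => TangentSpace (𝓡 2) x →L[ℝ] TangentSpace (𝓡 2) x →L[ℝ] ℝ) x (form x))

/-- The function `β / ρ`, for 2-forms `β` and `ρ` on a two-dimensional space with `ρ ≠ 0`. -/
def formRatio (β ρ : Euc 2 → Euc 2 → ℝ) : ℝ :=
  β (basisVec 2 0) (basisVec 2 1) / ρ (basisVec 2 0) (basisVec 2 1)

section Immersed

variable {S M : Type*} [TopologicalSpace S] [ChartedSpace (Euc 2) S] [IsManifold (𝓡 2) ∞ S]
  [TopologicalSpace M] [ChartedSpace (Euc 4) M] [IsManifold (𝓡 4) ∞ M]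

/-- The Kähler forms `ω_a(v,w) = g(J_a v, w)`, for `J_a = I, J, K`. -/
def kahlerForm (𝓗 : HyperKahler M) (a : Fin 3) (y : M) (v w : TangentSpace (𝓡 4) y) : ℝ :=
  𝓗.metric.inner y (𝓗.cplx a y v) w

/-- The functions `N_a = f^*ω_a / ρ`. -/
def momentFn (𝓗 : HyperKahler M) (ρ : AreaForm S) (f : S → M) (a : Fin 3) (x : S) : ℝ :=
  formRatio
    (fun v w => kahlerForm 𝓗 a (f x) (mfderiv (𝓡 2) (𝓡 4) f x v) (mfderiv (𝓡 2) (𝓡 4) f x w))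
    (fun v w => ρ.form x v w)

/-- The induced metric `f^*g`. -/
def inducedMetric (𝓗 : HyperKahler M) (f : S → M) (x : S) :
    TangentSpace (𝓡 2) x →L[ℝ] TangentSpace (𝓡 2) x →L[ℝ] ℝ :=
  pullForm (𝓗.metric.inner (f x)) (mfderiv (𝓡 2) (𝓡 4) f x)

/-- The area form `dμ` of the induced metric, for the orientation given by `ρ`: on `(v,w)` it is the
area of the parallelogram spanned by `v` and `w`, with the sign of `ρ(v,w)`. -/
def inducedArea (𝓗 : HyperKahler M) (ρ : AreaForm S) (f : S → M) (x : S)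
    (v w : TangentSpace (𝓡 2) x) : ℝ :=
  (SignType.sign (ρ.form x v w) : ℝ) *
    Real.sqrt (inducedMetric 𝓗 f x v v * inducedMetric 𝓗 f x w w - inducedMetric 𝓗 f x v w ^ 2)

/-- The function `λ = dμ / ρ`. -/
def lam (𝓗 : HyperKahler M) (ρ : AreaForm S) (f : S → M) (x : S) : ℝ :=
  formRatio (fun v w => inducedArea 𝓗 ρ f x v w) (fun v w => ρ.form x v w)

/-- The orthogonal projection of a tangent vector of `M` at `f x` to the normal space of the
immersion `f` at `x`. -/
def normalPart (𝓗 : HyperKahler M) (f : S → M) (x : S) (V : TangentSpace (𝓡 4) (f x)) :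
    TangentSpace (𝓡 4) (f x) :=
  V - metricTrace (inducedMetric 𝓗 f x) fun a b =>
    𝓗.metric.inner (f x) V (mfderiv (𝓡 2) (𝓡 4) f x a) • mfderiv (𝓡 2) (𝓡 4) f x b

/-- The derivative along `f`, for the Levi-Civita connection of `M`, of the coordinate vector
fields: for `v = ∂_i`, `w = ∂_j` in the chart at `x` this is the derivative of `f_*∂_j` in the
direction `∂_i`, whose components in the chart at `f x` are
`∂_i ∂_j f^A + Γ^A_{BC} ∂_i f^B ∂_j f^C`. -/
def covDerivAlong (𝓗 : HyperKahler M) (f : S → M) (x : S) (v w : TangentSpace (𝓡 2) x) :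
    TangentSpace (𝓡 4) (f x) :=
  (fderiv ℝ (fderiv ℝ (writtenInExtChartAt (𝓡 2) (𝓡 4) x f)) (extChartAt (𝓡 2) x x) v w : Euc 4)
    + christoffel 𝓗.metric.inner (f x) (mfderiv (𝓡 2) (𝓡 4) f x v) (mfderiv (𝓡 2) (𝓡 4) f x w)

/-- The second fundamental form `A(v,w)`, with values in the normal bundle. -/
def secondFF (𝓗 : HyperKahler M) (f : S → M) (x : S) (v w : TangentSpace (𝓡 2) x) :
    TangentSpace (𝓡 4) (f x) :=
  normalPart 𝓗 f x (covDerivAlong 𝓗 f x v w)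

/-- The mean curvature vector `H = g^{ij} A(∂_i, ∂_j)`. -/
def meanCurv (𝓗 : HyperKahler M) (f : S → M) (x : S) : TangentSpace (𝓡 4) (f x) :=
  metricTrace (inducedMetric 𝓗 f x) fun a b => secondFF 𝓗 f x a b

/-- `|H|²`. -/
def meanCurvSq (𝓗 : HyperKahler M) (f : S → M) (x : S) : ℝ :=
  𝓗.metric.inner (f x) (meanCurv 𝓗 f x) (meanCurv 𝓗 f x)

/-- `e` is an orthonormal basis of the normal space of the immersion `f` at `x`. -/
def IsNormalFrame (𝓗 : HyperKahler M) (f : S → M) (x : S)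
    (e : Fin 2 → TangentSpace (𝓡 4) (f x)) : Prop :=
  (∀ α β, 𝓗.metric.inner (f x) (e α) (e β) = if α = β then 1 else 0) ∧
  (∀ α v, 𝓗.metric.inner (f x) (e α) (mfderiv (𝓡 2) (𝓡 4) f x v) = 0)

/-- The family `f t`, for `t` in the time interval `τ`, is a smooth solution, through immersions, of
`∂f/∂t = I f_*ξ₁ + J f_*ξ₂ + K f_*ξ₃`, where `ξ_a` is the Hamiltonian vector field of `N_a`, that is
`ρ(ξ_a, ·) = dN_a`. At an endpoint of `τ` that belongs to `τ` the time derivative is one-sided. -/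
structure IsHFlow (𝓗 : HyperKahler M) (ρ : AreaForm S) (τ : Set ℝ) (f : ℝ → S → M) : Prop where
  smooth : ContMDiffOn (𝓘(ℝ, ℝ).prod (𝓡 2)) (𝓡 4) ∞ (fun z : ℝ × S => f z.1 z.2) (τ ×ˢ univ)
  immersion : ∀ t ∈ τ, ∀ x, Function.Injective (mfderiv (𝓡 2) (𝓡 4) (f t) x)
  flow : ∀ t ∈ τ, ∀ x, ∃ ξ : Fin 3 → TangentSpace (𝓡 2) x,
    (∀ a v, ρ.form x (ξ a) v = mfderiv (𝓡 2) 𝓘(ℝ, ℝ) (momentFn 𝓗 ρ (f t) a) x v) ∧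
    HasMFDerivWithinAt 𝓘(ℝ, ℝ) (𝓡 4) (fun s => f s x) τ t
      (ContinuousLinearMap.toSpanSingleton ℝ
        (∑ a, 𝓗.cplx a (f t x) (mfderiv (𝓡 2) (𝓡 4) (f t) x (ξ a))))

end Immersed

end HFlow

end

set_option linter.unusedSectionVars false

noncomputable section

namespace HFlow

/-! ### Linear algebra -/

/-! At each point, `x, Ix, Jx, Kx` are orthogonal of length `|x|`, so inner products satisfy a
Parseval identity (`IsQuaternionic.parseval`). Taking the two coordinate tangent vectors of the
surface, it gives `det g = ∑ ω_a(∂₁,∂₂)²`, that is `λ² = ∑ N_a²`.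

This determines the velocity `V = ∑ J_a f_*ξ_a`. Tangentially, `⟨V, f_*v⟩ = ∑ N_a ρ(ξ_a, v) = ∑ N_a
dN_a(v) = ½ d(λ²)(v)` (`inner_velocity_tangent`). For the normal part, the `J_a` are parallel, so
`dN_a` involves only the covariant derivatives of the `f_*∂_i`. Pairing with a normal vector and
summing over `a` by Parseval leaves exactly `det g` times the trace of the second fundamental form,
over `ρ₁₂²`; the normal part is `λ²H` (`inner_velocity_normal`).

Thus `V = ½∇λ² + λ²H`. The first variation of `g` along `V` is the Hessian of `λ²` minus `2λ²⟨H, A⟩`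
(`metric_variation`). Its trace gives the evolution of `det g` by Jacobi's formula, hence that of
`dμ = √(det g)` and of `λ² = det g / ρ₁₂²`, because `ρ` does not depend on time.

For the bound, at a spatial maximum of `λ²` the Laplacian is nonpositive and `-|H|²` only helps. So
`λ² - εt` has no maximum at a positive time on `[0,t] × S`; then `ε → 0`.

The computation is done in the chart of `S` at `x₀` and the chart of `M` at `f t₀ x₀`. The
tangent-space identifications in the definitions change from point to point, so the bridge to
coordinates rests on ratios of 2-forms being independent of the basis, and on the chart frame at its
own centre being the identity. -/

/-- A vector orthogonal to a basis, for a definite form, vanishes. -/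
lemma eq_zero_of_orthogonal {n : ℕ} {G : Euc n →L[ℝ] Euc n →L[ℝ] ℝ}
    (hpos : ∀ v, v ≠ 0 → 0 < G v v) {b : Fin n → Euc n} (hb : LinearIndependent ℝ b)
    {z : Euc n} (hz : ∀ i, G (b i) z = 0) : z = 0 := by
  by_contra h
  have hspan : ⊤ ≤ Submodule.span ℝ (Set.range b) :=
    (hb.span_eq_top_of_card_eq_finrank' (by simp)).ge
  have key : ∀ w ∈ Submodule.span ℝ (Set.range b), G w z = 0 := by
    intro w hw
    induction hw using Submodule.span_induction with
    | mem x hx => obtain ⟨i, rfl⟩ := hx; exact hz i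
    | zero => simp
    | add x y _ _ hx hy => simp [hx, hy]
    | smul a x _ hx => simp [hx]
  exact (hpos z h).ne' (key z (hspan trivial))

/-- An almost complex quaternionic structure on `ℝ⁴`, orthogonal for an inner product. -/
structure IsQuaternionic (G : Euc 4 →L[ℝ] Euc 4 →L[ℝ] ℝ) (J : Fin 3 → Euc 4 →L[ℝ] Euc 4) :
    Prop where
  symm : ∀ v w, G v w = G w v
  pos : ∀ v, v ≠ 0 → 0 < G v v
  sq : ∀ a v, J a (J a v) = -v
  quat : ∀ v, J 0 (J 1 v) = J 2 v
  orth : ∀ a v w, G (J a v) (J a w) = G v w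

namespace IsQuaternionic

variable {G : Euc 4 →L[ℝ] Euc 4 →L[ℝ] ℝ} {J : Fin 3 → Euc 4 →L[ℝ] Euc 4}

lemma skew (h : IsQuaternionic G J) (a : Fin 3) (v w : Euc 4) : G (J a v) w = -G (J a w) v := by
  rw [← h.orth a (J a v) w, h.sq, h.symm (J a w)]
  simp

lemma self (h : IsQuaternionic G J) (a : Fin 3) (v : Euc 4) : G (J a v) v = 0 := by
  have := h.skew a v v
  linarith

/-- `|x|² ⟨y, w⟩` expanded in the orthogonal basis `x, Ix, Jx, Kx`. -/
lemma parseval (h : IsQuaternionic G J) (x y w : Euc 4) :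
    G x x * G y w = G x y * G x w + ∑ a, G (J a x) y * G (J a x) w := by
  rcases eq_or_ne x 0 with rfl | hx
  · simp
  have hx0 := (h.pos x hx).ne'
  -- Since `K = IJ`, orthogonality reduces all three products to the form `⟨J_a v, v⟩ = 0`.
  have h01 : G (J 0 x) (J 1 x) = 0 := by
    rw [← h.orth 0, h.sq, h.quat, h.symm]; simp [h.self]
  have h02 : G (J 0 x) (J 2 x) = 0 := by
    rw [← h.quat, h.orth, h.symm]; exact h.self _ _
  have h12 : G (J 1 x) (J 2 x) = 0 := by
    rw [← h.quat, h.symm]; exact h.self _ _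
  let b : Fin 4 → Euc 4 := ![x, J 0 x, J 1 x, J 2 x]
  have hb : ∀ i j, G (b i) (b j) = if i = j then G x x else 0 := by
    intro i j
    fin_cases i <;> fin_cases j <;>
      simp [b, h.orth, h.self, h01, h02, h12, h.symm (J 1 x) (J 0 x), h.symm (J 2 x) (J 0 x),
        h.symm (J 2 x) (J 1 x), h.symm x]
  have hli : LinearIndependent ℝ b := by
    rw [Fintype.linearIndependent_iff]
    intro c hc i
    have : G (b i) (∑ j, c j • b j) = c i * G x x := by simp [hb]
    rw [hc, map_zero] at this
    simpa [hx0] using this.symm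
  -- The orthogonal expansion of `y`, multiplied by `|x|²` to avoid division: the remainder is
  -- orthogonal to the whole basis.
  have hz := eq_zero_of_orthogonal h.pos hli (z := G x x • y - ∑ j, G (b j) y • b j)
    (fun i => by simp [hb, mul_comm])
  have := congrArg (G w) hz
  simp [b, Fin.sum_univ_four, h.symm w] at this
  rw [Fin.sum_univ_three]
  linarith

/-- Polarisation of `parseval` in `x`. It handles the off-diagonal terms with `g₀₁` in the trace
that produces the mean curvature. -/
lemma parseval_polar (h : IsQuaternionic G J) (x z y w : Euc 4) :
    ∑ a, (G (J a x) y * G (J a z) w + G (J a z) y * G (J a x) w)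
      = 2 * G x z * G y w - G x y * G z w - G z y * G x w := by
  have h1 := h.parseval (x + z) y w
  have h2 := h.parseval x y w
  have h3 := h.parseval z y w
  simp only [map_add, _root_.add_apply, Fin.sum_univ_three] at h1 h2 h3 ⊢
  rw [h.symm z x] at h1
  linarith

end IsQuaternionic

/-- The determinant `v⁰w¹ - v¹w⁰`. -/
def wedge (v w : Euc 2) : ℝ := v 0 * w 1 - v 1 * w 0

lemma eq_smul_basisVec (v : Euc 2) : v = v 0 • basisVec 2 0 + v 1 • basisVec 2 1 := by
  ext i
  fin_cases i <;> simp [basisVec]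

/-- The 2-forms on a plane form a line. This is why `N_a` and `λ`, defined through one basis, can be
evaluated in any other. -/
lemma alternating_apply {B : Euc 2 →L[ℝ] Euc 2 →L[ℝ] ℝ} (hB : ∀ v, B v v = 0) (v w : Euc 2) :
    B v w = wedge v w * B (basisVec 2 0) (basisVec 2 1) := by
  have h : B (basisVec 2 1) (basisVec 2 0) = - B (basisVec 2 0) (basisVec 2 1) := by
    have := hB (basisVec 2 0 + basisVec 2 1)
    simp [hB] at this
    linarith
  conv_lhs => rw [eq_smul_basisVec v, eq_smul_basisVec w]
  simp [hB, h, wedge]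
  ring

/-- The Gram determinant of a symmetric bilinear form on `ℝ²`. -/
def gramDet (B : Euc 2 →L[ℝ] Euc 2 →L[ℝ] ℝ) : ℝ :=
  B (basisVec 2 0) (basisVec 2 0) * B (basisVec 2 1) (basisVec 2 1)
    - B (basisVec 2 0) (basisVec 2 1) ^ 2

lemma gramDet_apply {B : Euc 2 →L[ℝ] Euc 2 →L[ℝ] ℝ} (hB : ∀ v w, B v w = B w v) (v w : Euc 2) :
    B v v * B w w - B v w ^ 2 = wedge v w ^ 2 * gramDet B := by
  conv_lhs => rw [eq_smul_basisVec v, eq_smul_basisVec w]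
  simp [wedge, gramDet, hB (basisVec 2 1) (basisVec 2 0)]
  ring

lemma wedge_ne_zero {D : Euc 2 →L[ℝ] Euc 2} (hD : Function.Injective D) :
    wedge (D (basisVec 2 0)) (D (basisVec 2 1)) ≠ 0 := by
  intro h
  set X := D (basisVec 2 0) with hX
  set Y := D (basisVec 2 1) with hY
  unfold wedge at h
  -- If `X` and `Y` are parallel, this vector and the one in `h1` lie in the kernel of `D`. Their
  -- second coordinates are `-X 0` and `-X 1`, so injectivity gives `X = 0`.
  have h0 : D (Y 0 • basisVec 2 0 - X 0 • basisVec 2 1) = D 0 := by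
    rw [map_sub, map_smul, map_smul, ← hX, ← hY, map_zero]
    ext i; fin_cases i
    · simp; ring
    · simp; linarith
  have h1 : D (Y 1 • basisVec 2 0 - X 1 • basisVec 2 1) = D 0 := by
    rw [map_sub, map_smul, map_smul, ← hX, ← hY, map_zero]
    ext i; fin_cases i
    · simp; linarith
    · simp; ring
  have e0 := hD h0
  have e1 := hD h1
  have a0 := congrArg (fun v : Euc 2 => v 1) e0
  have a1 := congrArg (fun v : Euc 2 => v 1) e1
  simp [basisVec] at a0 a1
  have hX0 : D (basisVec 2 0) = D 0 := by
    rw [← hX, map_zero]; ext i; fin_cases i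
    · simpa using a0
    · simpa using a1
  have := congrArg (fun v : Euc 2 => v 0) (hD hX0)
  simp [basisVec] at this

lemma gramDet_pos {B : Euc 2 →L[ℝ] Euc 2 →L[ℝ] ℝ} (hB : ∀ v w, B v w = B w v)
    (hpos : ∀ v, v ≠ 0 → 0 < B v v) :
    0 < gramDet B := by
  have h0 : 0 < B (basisVec 2 0) (basisVec 2 0) :=
    hpos _ (fun h => by simpa [basisVec] using congrArg (fun v : Euc 2 => v 0) h)
  -- Gram–Schmidt without division: on this vector the form takes the value `B₀₀ · det B`.
  have h1 := hpos (B (basisVec 2 0) (basisVec 2 0) • basisVec 2 1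
      - B (basisVec 2 0) (basisVec 2 1) • basisVec 2 0) (fun h => by
        have := congrArg (fun v : Euc 2 => v 1) h
        simp [basisVec] at this h0
        exact h0.ne' this)
  simp [hB (basisVec 2 1) (basisVec 2 0)] at h1
  rw [gramDet]
  refine pos_of_mul_pos_right (a := B (basisVec 2 0) (basisVec 2 0)) ?_ h0.le
  linarith

lemma metricTrace_two {V : Type*} [AddCommGroup V] [Module ℝ V]
    {B : Euc 2 →L[ℝ] Euc 2 →L[ℝ] ℝ} (hB : ∀ v w, B v w = B w v) (T : Euc 2 → Euc 2 → V) :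
    metricTrace B T = (gramDet B)⁻¹ •
      (B (basisVec 2 1) (basisVec 2 1) • T (basisVec 2 0) (basisVec 2 0)
        - B (basisVec 2 0) (basisVec 2 1) • T (basisVec 2 0) (basisVec 2 1)
        - B (basisVec 2 0) (basisVec 2 1) • T (basisVec 2 1) (basisVec 2 0)
        + B (basisVec 2 0) (basisVec 2 0) • T (basisVec 2 1) (basisVec 2 1)) := by
  simp only [metricTrace, Fin.sum_univ_two, Matrix.inv_def, Matrix.det_fin_two,
    Matrix.adjugate_fin_two, gram, gramDet, Ring.inverse_eq_inv', Matrix.smul_apply, Matrix.of_apply,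
    Matrix.cons_val', Matrix.cons_val_zero, Matrix.cons_val_one, Matrix.cons_val_fin_one,
    smul_eq_mul, hB (basisVec 2 1) (basisVec 2 0), pow_two]
  module

lemma map_metricTrace {n : ℕ} {V W : Type*} [AddCommGroup V] [Module ℝ V] [AddCommGroup W]
    [Module ℝ W] (L : V →ₗ[ℝ] W) (B : Euc n →L[ℝ] Euc n →L[ℝ] ℝ) (T : Euc n → Euc n → V) :
    L (metricTrace B T) = metricTrace B fun a b => L (T a b) := by
  simp [metricTrace]

lemma eq_sum_basisVec {n : ℕ} (v : Euc n) : v = ∑ i, v i • basisVec n i := by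
  ext j
  simp [basisVec, Finset.sum_apply, Pi.single_apply]

lemma isUnit_det_gram {n : ℕ} {B : Euc n →L[ℝ] Euc n →L[ℝ] ℝ} (hpos : ∀ v, v ≠ 0 → 0 < B v v) :
    IsUnit (gram B).det := by
  rw [isUnit_iff_ne_zero]
  intro h
  obtain ⟨v, hv, hv'⟩ := Matrix.exists_mulVec_eq_zero_iff.2 h
  have hz : WithLp.toLp 2 v ≠ (0 : Euc n) := by
    intro h0
    exact hv (by simpa using congrArg WithLp.ofLp h0)
  have h1 : ∀ i, B (basisVec n i) (WithLp.toLp 2 v) = 0 := by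
    intro i
    rw [eq_sum_basisVec (WithLp.toLp 2 v)]
    have := congrFun hv' i
    simpa [Matrix.mulVec, dotProduct, gram, mul_comm] using this
  refine (hpos _ hz).ne' ?_
  have h2 : (B.flip (WithLp.toLp 2 v)) (∑ i, v i • basisVec n i) = 0 := by
    simp [h1]
  rwa [← eq_sum_basisVec (WithLp.toLp 2 v)] at h2

/-- Raising an index: the vector `B^{ij} L(∂_i) ∂_j` represents the linear form `L`. -/
lemma inner_metricTrace_smul {n : ℕ} {B : Euc n →L[ℝ] Euc n →L[ℝ] ℝ}
    (hpos : ∀ v, v ≠ 0 → 0 < B v v) (L : Euc n →ₗ[ℝ] ℝ) (z : Euc n) :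
    B (metricTrace B fun a b => L a • b) z = L z := by
  have key : ∀ k, B (metricTrace B fun a b => L a • b) (basisVec n k) = L (basisVec n k) := by
    intro k
    have h := Matrix.nonsing_inv_mul (gram B) (isUnit_det_gram hpos)
    have : ∀ i, ∑ j, (gram B)⁻¹ i j * B (basisVec n j) (basisVec n k) = if i = k then 1 else 0 := by
      intro i
      have := congrFun (congrFun h i) k
      simpa [Matrix.mul_apply, gram, Matrix.one_apply] using this
    simp only [metricTrace, map_sum, map_smul, _root_.sum_apply,
      _root_.smul_apply, smul_eq_mul]
    calc _ = ∑ i, L (basisVec n i) * ∑ j, (gram B)⁻¹ i j * B (basisVec n j) (basisVec n k) := by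
          refine Finset.sum_congr rfl fun i _ => ?_
          rw [Finset.mul_sum]
          exact Finset.sum_congr rfl fun j _ => by ring
      _ = _ := by simp [this]
  rw [eq_sum_basisVec z]
  simp [key]

/-! ### Mixed derivatives up to the boundary of the time interval -/

section Mixed

variable {E E' : Type*} [NormedAddCommGroup E] [NormedSpace ℝ E] [NormedAddCommGroup E']
  [NormedSpace ℝ E'] {F : ℝ × E → E'} {T : Set ℝ} {U : Set E}

lemma hasFDerivAt_slice (hU : IsOpen U) (hF : DifferentiableOn ℝ F (T ×ˢ U)) {z : ℝ × E}
    (hz : z ∈ T ×ˢ U) :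
    HasFDerivAt (fun y => F (z.1, y))
      ((fderivWithin ℝ F (T ×ˢ U) z).comp (ContinuousLinearMap.inr ℝ ℝ E)) z.2 := by
  have h1 := (hF z hz).hasFDerivWithinAt
  have h2 : HasFDerivWithinAt (fun y : E => (z.1, y)) (ContinuousLinearMap.inr ℝ ℝ E) U z.2 :=
    (hasFDerivAt_prodMk_right z.1 z.2).hasFDerivWithinAt
  have h3 : HasFDerivWithinAt F (fderivWithin ℝ F (T ×ˢ U) z) (T ×ˢ U) (z.1, z.2) := h1
  have hm : MapsTo (fun y : E => (z.1, y)) U (T ×ˢ U) := fun y hy => ⟨hz.1, hy⟩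
  exact (h3.comp z.2 h2 hm).hasFDerivAt (hU.mem_nhds hz.2)

lemma hasDerivWithinAt_slice (hF : DifferentiableOn ℝ F (T ×ˢ U)) {z : ℝ × E}
    (hz : z ∈ T ×ˢ U) :
    HasDerivWithinAt (fun s => F (s, z.2)) (fderivWithin ℝ F (T ×ˢ U) z (1, 0)) T z.1 := by
  have h3 : HasFDerivWithinAt F (fderivWithin ℝ F (T ×ˢ U) z) (T ×ˢ U) (z.1, z.2) :=
    (hF z hz).hasFDerivWithinAt
  have h2 : HasDerivWithinAt (fun s : ℝ => (s, z.2)) ((1 : ℝ), (0 : E)) T z.1 :=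
    (hasDerivWithinAt_id _ _).prodMk (hasDerivWithinAt_const _ _ _)
  have hm : MapsTo (fun s : ℝ => (s, z.2)) T (T ×ˢ U) := fun s hs => ⟨hs, hz.2⟩
  exact h3.comp_hasDerivWithinAt z.1 h2 hm

lemma continuousOn_fderiv_slice (hT : UniqueDiffOn ℝ T) (hU : IsOpen U)
    (hF : ContDiffOn ℝ ∞ F (T ×ˢ U)) :
    ContinuousOn (fun z : ℝ × E => fderiv ℝ (fun y => F (z.1, y)) z.2) (T ×ˢ U) := by
  have h := hF.continuousOn_fderivWithin (hT.prod hU.uniqueDiffOn) (by simp)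
  refine (h.clm_comp (continuousOn_const (c := ContinuousLinearMap.inr ℝ ℝ E))).congr ?_
  intro z hz
  exact (hasFDerivAt_slice hU (hF.differentiableOn (by simp)) hz).fderiv

/-- The time derivative and the space derivatives of a smooth family commute, also at the ends of
the time interval. -/
lemma hasDerivWithinAt_fderiv_slice (hT : Convex ℝ T) (hT' : (interior T).Nonempty) (hU : IsOpen U)
    (hF : ContDiffOn ℝ ∞ F (T ×ˢ U)) {V : E → E'} {t : ℝ} (ht : t ∈ T)
    (hV : ∀ y ∈ U, HasDerivWithinAt (fun s => F (s, y)) (V y) T t) {y : E} (hy : y ∈ U) (k : E) :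
    DifferentiableAt ℝ V y ∧
    HasDerivWithinAt (fun s => fderiv ℝ (fun y => F (s, y)) y k) (fderiv ℝ V y k) T t := by
  have hTu : UniqueDiffOn ℝ T := uniqueDiffOn_convex hT hT'
  have hu : UniqueDiffOn ℝ (T ×ˢ U) := hTu.prod hU.uniqueDiffOn
  have hz : (t, y) ∈ T ×ˢ U := ⟨ht, hy⟩
  have hd : DifferentiableOn ℝ F (T ×ˢ U) := hF.differentiableOn (by simp)
  have hDd : DifferentiableOn ℝ (fderivWithin ℝ F (T ×ˢ U)) (T ×ˢ U) :=
    (hF.fderivWithin (m := ∞) hu (by simp)).differentiableOn (by simp)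
  -- At an end of the time interval, symmetry of the second derivative survives because the point is
  -- in the closure of the interior of `T ×ˢ U`; convexity of `T` supplies this.
  have hsymm : IsSymmSndFDerivWithinAt ℝ F (T ×ˢ U) (t, y) := by
    refine (hF (t, y) hz).isSymmSndFDerivWithinAt (by simpa using ENat.LEInfty.out) hu ?_ hz
    rw [interior_prod_eq, closure_prod_eq, hU.interior_eq]
    refine ⟨?_, subset_closure hy⟩
    rw [hT.closure_interior_eq_closure_of_nonempty_interior hT']
    exact subset_closure ht
  have h5 := hsymm.eq ((1 : ℝ), (0 : E)) ((0 : ℝ), k)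
  have hVD : ∀ x ∈ U, V x = fderivWithin ℝ F (T ×ˢ U) (t, x) (1, 0) := by
    intro x hx
    have := hasDerivWithinAt_slice hd (z := (t, x)) ⟨ht, hx⟩
    exact (hTu t ht).eq_deriv T (hV x hx) this
  have hxD : ∀ s ∈ T, fderiv ℝ (fun y => F (s, y)) y k
      = fderivWithin ℝ F (T ×ˢ U) (s, y) (0, k) := by
    intro s hs
    rw [(hasFDerivAt_slice hU hd (z := (s, y)) ⟨hs, hy⟩).fderiv]
    simp
  -- With the first derivative treated as a field `D`, both mixed derivatives are entries of the
  -- derivative of `D` at `(t, y)`, and `h5` identifies them.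
  generalize fderivWithin ℝ F (T ×ˢ U) = D at *
  have h1 := hasFDerivAt_slice hU hDd hz
  have h2 : HasFDerivAt V ((ContinuousLinearMap.apply ℝ E' ((1 : ℝ), (0 : E))).comp
      ((fderivWithin ℝ D (T ×ˢ U) (t, y)).comp (ContinuousLinearMap.inr ℝ ℝ E))) y := by
    refine ((ContinuousLinearMap.apply ℝ E' ((1 : ℝ), (0 : E))).hasFDerivAt.comp y
      h1).congr_of_eventuallyEq ?_
    filter_upwards [hU.mem_nhds hy] with x hx
    exact hVD x hx
  refine ⟨h2.differentiableAt, ?_⟩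
  have h3 := hasDerivWithinAt_slice hDd hz
  have h4 : HasDerivWithinAt (fun s => D (s, y) (0, k))
      (fderivWithin ℝ D (T ×ˢ U) (t, y) (1, 0) (0, k)) T t :=
    (ContinuousLinearMap.apply ℝ E' ((0 : ℝ), k)).hasFDerivAt.comp_hasDerivWithinAt t h3
  rw [h2.fderiv]
  rw [h5] at h4
  exact h4.congr hxD (hxD t ht)

end Mixed

/-! ### Product and chain rules for forms with variable coefficients. -/

section Bilin

/-- A shortcut instance. -/
instance formNormedAddCommGroup {E : Type*} [NormedAddCommGroup E] [NormedSpace ℝ E] :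
    NormedAddCommGroup (E →L[ℝ] E →L[ℝ] ℝ) :=
  ContinuousLinearMap.toNormedAddCommGroup

/-- A shortcut instance. -/
instance formNormedSpace {E : Type*} [NormedAddCommGroup E] [NormedSpace ℝ E] :
    NormedSpace ℝ (E →L[ℝ] E →L[ℝ] ℝ) :=
  ContinuousLinearMap.toNormedSpace

variable {E E' E'' : Type*} [NormedAddCommGroup E] [NormedSpace ℝ E] [NormedAddCommGroup E']
  [NormedSpace ℝ E'] [NormedAddCommGroup E''] [NormedSpace ℝ E''] {c : E → E' →L[ℝ] E' →L[ℝ] ℝ} {a b : E → E'} {y : E}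

lemma hasFDerivAt_bilin_apply (hc : DifferentiableAt ℝ c y) (ha : DifferentiableAt ℝ a y)
    (hb : DifferentiableAt ℝ b y) :
    DifferentiableAt ℝ (fun x => c x (a x) (b x)) y ∧ ∀ v,
      fderiv ℝ (fun x => c x (a x) (b x)) y v = fderiv ℝ c y v (a y) (b y)
        + c y (fderiv ℝ a y v) (b y) + c y (a y) (fderiv ℝ b y v) := by
  have h := (hc.hasFDerivAt.clm_apply ha.hasFDerivAt).clm_apply hb.hasFDerivAt
  refine ⟨h.differentiableAt, fun v => ?_⟩
  rw [h.fderiv]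
  simp
  ring

lemma fderiv_bilin_const (hc : DifferentiableAt ℝ c y) (v : E) (w z : E') :
    fderiv ℝ c y v w z = fderiv ℝ (fun x => c x w z) y v := by
  rw [(hasFDerivAt_bilin_apply hc (differentiableAt_const w) (differentiableAt_const z)).2 v]
  simp

lemma fderiv_clm_const {φ : E → E' →L[ℝ] E''} (hφ : DifferentiableAt ℝ φ y) (v : E) (w : E') :
    fderiv ℝ (fun z => φ z w) y v = fderiv ℝ φ y v w := by
  rw [fderiv_clm_apply hφ (differentiableAt_const w)]
  simp

lemma fderiv_comp_apply {φ : E' → E''} {f : E → E'} (hφ : DifferentiableAt ℝ φ (f y))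
    (hf : DifferentiableAt ℝ f y) (v : E) :
    fderiv ℝ (fun x => φ (f x)) y v = fderiv ℝ φ (f y) (fderiv ℝ f y v) := by
  rw [fderiv_fun_comp y hφ hf]
  rfl

end Bilin

/-! ### Surfaces in a coordinate domain of a hyperkähler manifold -/

/-- Metric coefficients of the surface `F`. -/
def coordMetric (G : Euc 4 → Euc 4 →L[ℝ] Euc 4 →L[ℝ] ℝ) (F : Euc 2 → Euc 4) (y : Euc 2) :
    Euc 2 →L[ℝ] Euc 2 →L[ℝ] ℝ :=
  pullForm (G (F y)) (fderiv ℝ F y)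

/-- The component of the pullback of the `a`-th Kähler form. -/
def coordKahler (G : Euc 4 → Euc 4 →L[ℝ] Euc 4 →L[ℝ] ℝ) (J : Fin 3 → Euc 4 → Euc 4 →L[ℝ] Euc 4)
    (F : Euc 2 → Euc 4) (a : Fin 3) (y : Euc 2) : ℝ :=
  G (F y) (J a (F y) (fderiv ℝ F y (basisVec 2 0))) (fderiv ℝ F y (basisVec 2 1))

/-- The function `λ²` in coordinates. -/
def coordLamSq (G : Euc 4 → Euc 4 →L[ℝ] Euc 4 →L[ℝ] ℝ) (r : Euc 2 → ℝ) (F : Euc 2 → Euc 4)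
    (y : Euc 2) : ℝ :=
  gramDet (coordMetric G F y) / r y ^ 2

/-- The coordinate expression of an immersed surface, with an area form `r dx¹ ∧ dx²`, in a domain
with a smooth metric `G` and a smooth orthogonal almost quaternionic structure `J`. -/
structure IsCoordImmersion (G : Euc 4 → Euc 4 →L[ℝ] Euc 4 →L[ℝ] ℝ)
    (J : Fin 3 → Euc 4 → Euc 4 →L[ℝ] Euc 4) (W : Set (Euc 4)) (r : Euc 2 → ℝ) (U : Set (Euc 2))
    (F : Euc 2 → Euc 4) : Prop where
  isOpen_target : IsOpen W
  isOpen_source : IsOpen U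
  metric_smooth : ContDiffOn ℝ ∞ G W
  cplx_smooth : ∀ a, ContDiffOn ℝ ∞ (J a) W
  quaternionic : ∀ z ∈ W, IsQuaternionic (G z) (fun a => J a z)
  area_smooth : ContDiffOn ℝ ∞ r U
  area_ne_zero : ∀ y ∈ U, r y ≠ 0
  smooth : ContDiffOn ℝ ∞ F U
  mapsTo : MapsTo F U W
  injective : ∀ y ∈ U, Function.Injective (fderiv ℝ F y)

namespace IsCoordImmersion

variable {G : Euc 4 → Euc 4 →L[ℝ] Euc 4 →L[ℝ] ℝ} {J : Fin 3 → Euc 4 → Euc 4 →L[ℝ] Euc 4}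
  {W : Set (Euc 4)} {r : Euc 2 → ℝ} {U : Set (Euc 2)} {F : Euc 2 → Euc 4} {y : Euc 2}

lemma fderiv_smooth (h : IsCoordImmersion G J W r U F) : ContDiffOn ℝ ∞ (fderiv ℝ F) U :=
  h.smooth.fderiv_of_isOpen h.isOpen_source (by simp)

lemma metric_comp_smooth (h : IsCoordImmersion G J W r U F) :
    ContDiffOn ℝ ∞ (fun y => G (F y)) U :=
  h.metric_smooth.comp h.smooth h.mapsTo

lemma cplx_comp_smooth (h : IsCoordImmersion G J W r U F) (a : Fin 3) :
    ContDiffOn ℝ ∞ (fun y => J a (F y)) U :=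
  (h.cplx_smooth a).comp h.smooth h.mapsTo

lemma coordMetric_apply_smooth (h : IsCoordImmersion G J W r U F) (v w : Euc 2) :
    ContDiffOn ℝ ∞ (fun y => coordMetric G F y v w) U :=
  (h.metric_comp_smooth.clm_apply (h.fderiv_smooth.clm_apply contDiffOn_const)).clm_apply
    (h.fderiv_smooth.clm_apply contDiffOn_const)

lemma coordMetric_smooth (h : IsCoordImmersion G J W r U F) :
    ContDiffOn ℝ ∞ (coordMetric G F) U := by
  simp only [contDiffOn_clm_apply]
  exact h.coordMetric_apply_smooth

lemma coordKahler_smooth (h : IsCoordImmersion G J W r U F) (a : Fin 3) :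
    ContDiffOn ℝ ∞ (coordKahler G J F a) U :=
  (h.metric_comp_smooth.clm_apply ((h.cplx_comp_smooth a).clm_apply
    (h.fderiv_smooth.clm_apply contDiffOn_const))).clm_apply
    (h.fderiv_smooth.clm_apply contDiffOn_const)

lemma coordLamSq_smooth (h : IsCoordImmersion G J W r U F) :
    ContDiffOn ℝ ∞ (coordLamSq G r F) U := by
  refine ContDiffOn.div ?_ (h.area_smooth.pow 2) (fun y hy => pow_ne_zero 2 (h.area_ne_zero y hy))
  exact ((h.coordMetric_apply_smooth _ _).mul (h.coordMetric_apply_smooth _ _)).sub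
    ((h.coordMetric_apply_smooth _ _).pow 2)

lemma differentiableAt {E : Type*} [NormedAddCommGroup E] [NormedSpace ℝ E] {φ : Euc 2 → E}
    (h : IsCoordImmersion G J W r U F) (hφ : ContDiffOn ℝ ∞ φ U) (hy : y ∈ U) :
    DifferentiableAt ℝ φ y :=
  (hφ.differentiableOn (by simp)).differentiableAt (h.isOpen_source.mem_nhds hy)

lemma contDiffAt {E : Type*} [NormedAddCommGroup E] [NormedSpace ℝ E] {φ : Euc 2 → E}
    (h : IsCoordImmersion G J W r U F) (hφ : ContDiffOn ℝ ∞ φ U) (hy : y ∈ U) :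
    ContDiffAt ℝ ∞ φ y :=
  hφ.contDiffAt (h.isOpen_source.mem_nhds hy)

lemma fderiv_fderiv_symm {E : Type*} [NormedAddCommGroup E] [NormedSpace ℝ E] {φ : Euc 2 → E}
    (h : IsCoordImmersion G J W r U F) (hφ : ContDiffOn ℝ ∞ φ U) (hy : y ∈ U) (v w : Euc 2) :
    fderiv ℝ (fderiv ℝ φ) y v w = fderiv ℝ (fderiv ℝ φ) y w v :=
  ((h.contDiffAt hφ hy).isSymmSndFDerivAt (by simpa using ENat.LEInfty.out)).eq v w

lemma coordMetric_symm (h : IsCoordImmersion G J W r U F) (hy : y ∈ U) (v w : Euc 2) :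
    coordMetric G F y v w = coordMetric G F y w v :=
  (h.quaternionic _ (h.mapsTo hy)).symm _ _

lemma coordMetric_pos (h : IsCoordImmersion G J W r U F) (hy : y ∈ U) (v : Euc 2) (hv : v ≠ 0) :
    0 < coordMetric G F y v v :=
  (h.quaternionic _ (h.mapsTo hy)).pos _
    (fun h0 => hv (h.injective y hy (h0.trans (map_zero _).symm)))

/-- `λ² = N₁² + N₂² + N₃²`. -/
lemma coordLamSq_eq (h : IsCoordImmersion G J W r U F) (hy : y ∈ U) :
    coordLamSq G r F y = ∑ a, (coordKahler G J F a y / r y) ^ 2 := by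
  have hq := h.quaternionic _ (h.mapsTo hy)
  -- Parseval with `x = ∂₀F` and `y = w = ∂₁F` reads `g₀₀ g₁₁ = g₀₁² + ∑ ω_a(∂₀F, ∂₁F)²`.
  have := hq.parseval (fderiv ℝ F y (basisVec 2 0)) (fderiv ℝ F y (basisVec 2 1))
    (fderiv ℝ F y (basisVec 2 1))
  simp only [coordLamSq, gramDet, coordMetric, pullForm, coordKahler, div_pow,
    ContinuousLinearMap.bilinearComp_apply] at this ⊢
  rw [← Finset.sum_div, this]
  congr 1
  simp only [pow_two]
  ring

lemma coordKahler_apply (h : IsCoordImmersion G J W r U F) (hy : y ∈ U) (a : Fin 3)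
    (v w : Euc 2) :
    G (F y) (J a (F y) (fderiv ℝ F y v)) (fderiv ℝ F y w) = wedge v w * coordKahler G J F a y :=
  alternating_apply (B := pullForm ((G (F y)).comp (J a (F y))) (fderiv ℝ F y))
    (fun v => (h.quaternionic _ (h.mapsTo hy)).self a (fderiv ℝ F y v)) v w

/-- The tangential part of the velocity of the H-flow is `½ ∇ λ²`. -/
lemma inner_velocity_tangent (h : IsCoordImmersion G J W r U F) (hy : y ∈ U)
    {η : Fin 3 → Euc 2}
    (hη : ∀ a v, r y * wedge (η a) v = fderiv ℝ (fun x => coordKahler G J F a x / r x) y v)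
    (v : Euc 2) :
    G (F y) (∑ a, J a (F y) (fderiv ℝ F y (η a))) (fderiv ℝ F y v)
      = 1 / 2 * fderiv ℝ (coordLamSq G r F) y v := by
  have hN : ∀ a, DifferentiableAt ℝ (fun x => coordKahler G J F a x / r x) y := fun a =>
    h.differentiableAt ((h.coordKahler_smooth a).div h.area_smooth h.area_ne_zero) hy
  have h1 : coordLamSq G r F =ᶠ[nhds y] fun x => ∑ a, (coordKahler G J F a x / r x) ^ 2 := by
    filter_upwards [h.isOpen_source.mem_nhds hy] with x hx using h.coordLamSq_eq hx
  have h2 : HasFDerivAt (fun x => ∑ a, (coordKahler G J F a x / r x) ^ 2)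
      (∑ a, (2 * (coordKahler G J F a y / r y)) •
        fderiv ℝ (fun x => coordKahler G J F a x / r x) y) y := by
    refine HasFDerivAt.fun_sum fun a _ => ?_
    simpa using (hN a).hasFDerivAt.pow 2
  rw [h1.fderiv_eq, h2.fderiv, map_sum, _root_.sum_apply, _root_.sum_apply, Finset.mul_sum]
  refine Finset.sum_congr rfl fun a _ => ?_
  -- Termwise, `ω_a(η_a, v) = N_a ρ(η_a, v) = N_a dN_a(v)`.
  rw [h.coordKahler_apply hy, _root_.smul_apply, ← hη, smul_eq_mul]
  have := h.area_ne_zero y hy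
  field_simp

variable {Γ : Euc 4 → Euc 4 → Euc 4}

/-- The derivative along the surface of the coordinate fields, for the connection `Γ`. -/
def _root_.HFlow.coordCovDeriv (Γ : Euc 4 → Euc 4 → Euc 4) (F : Euc 2 → Euc 4) (y : Euc 2)
    (v w : Euc 2) : Euc 4 :=
  fderiv ℝ (fderiv ℝ F) y v w + Γ (fderiv ℝ F y v) (fderiv ℝ F y w)

lemma fderiv_metric_symm (h : IsCoordImmersion G J W r U F) (hy : y ∈ U) (v w z : Euc 4) :
    fderiv ℝ G (F y) v w z = fderiv ℝ G (F y) v z w := by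
  have hd : DifferentiableAt ℝ G (F y) := (h.metric_smooth.differentiableOn (by simp)).differentiableAt
    (h.isOpen_target.mem_nhds (h.mapsTo hy))
  rw [fderiv_bilin_const hd, fderiv_bilin_const hd]
  congr 1
  refine Filter.EventuallyEq.fderiv_eq ?_
  filter_upwards [h.isOpen_target.mem_nhds (h.mapsTo hy)] with x hx
  exact (h.quaternionic x hx).symm w z

/-- The two Koszul expressions add up, since `dG` is symmetric in its last two arguments. Here, as
below, `Γ` enters only through the first-kind identity `hΓ` at the single point `F y`: `christoffel`
is defined only at the centre of a chart. -/
lemma metric_compatible (h : IsCoordImmersion G J W r U F) (hy : y ∈ U)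
    (hΓ : ∀ v w z, G (F y) (Γ v w) z = 1 / 2 * (fderiv ℝ G (F y) v w z + fderiv ℝ G (F y) w v z
      - fderiv ℝ G (F y) z v w)) (v w z : Euc 4) :
    fderiv ℝ G (F y) v w z = G (F y) (Γ v w) z + G (F y) w (Γ v z) := by
  rw [(h.quaternionic _ (h.mapsTo hy)).symm w, hΓ, hΓ, h.fderiv_metric_symm hy v z w,
    h.fderiv_metric_symm hy w v z, h.fderiv_metric_symm hy z v w]
  ring

lemma christoffel_symm (h : IsCoordImmersion G J W r U F) (hy : y ∈ U)
    (hΓ : ∀ v w z, G (F y) (Γ v w) z = 1 / 2 * (fderiv ℝ G (F y) v w z + fderiv ℝ G (F y) w v z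
      - fderiv ℝ G (F y) z v w)) (v w : Euc 4) : Γ v w = Γ w v := by
  by_contra hne
  refine ((h.quaternionic _ (h.mapsTo hy)).pos _ (sub_ne_zero.2 hne)).ne' ?_
  rw [map_sub (G (F y)), _root_.sub_apply, hΓ, hΓ, h.fderiv_metric_symm hy _ v w]
  ring

lemma coordCovDeriv_symm (h : IsCoordImmersion G J W r U F) (hy : y ∈ U)
    (hΓ : ∀ v w z, G (F y) (Γ v w) z = 1 / 2 * (fderiv ℝ G (F y) v w z + fderiv ℝ G (F y) w v z
      - fderiv ℝ G (F y) z v w)) (v w : Euc 2) :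
    coordCovDeriv Γ F y v w = coordCovDeriv Γ F y w v := by
  rw [coordCovDeriv, coordCovDeriv, h.fderiv_fderiv_symm h.smooth hy, h.christoffel_symm hy hΓ]

lemma fderiv_metric_comp (h : IsCoordImmersion G J W r U F) (hy : y ∈ U) (v : Euc 2) :
    fderiv ℝ (fun x => G (F x)) y v = fderiv ℝ G (F y) (fderiv ℝ F y v) :=
  fderiv_comp_apply ((h.metric_smooth.differentiableOn (by simp)).differentiableAt
    (h.isOpen_target.mem_nhds (h.mapsTo hy))) (h.differentiableAt h.smooth hy) v

lemma fderiv_cplx_comp (h : IsCoordImmersion G J W r U F) (hy : y ∈ U) (a : Fin 3) (v : Euc 2) :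
    fderiv ℝ (fun x => J a (F x)) y v = fderiv ℝ (J a) (F y) (fderiv ℝ F y v) :=
  fderiv_comp_apply (((h.cplx_smooth a).differentiableOn (by simp)).differentiableAt
    (h.isOpen_target.mem_nhds (h.mapsTo hy))) (h.differentiableAt h.smooth hy) v

/-- The product rule produces a `dG` term, which `metric_compatible` splits into the two `Γ` terms
completing the second derivatives of `F` to covariant ones. -/
lemma fderiv_coordMetric (h : IsCoordImmersion G J W r U F) (hy : y ∈ U)
    (hΓ : ∀ v w z, G (F y) (Γ v w) z = 1 / 2 * (fderiv ℝ G (F y) v w z + fderiv ℝ G (F y) w v z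
      - fderiv ℝ G (F y) z v w)) (v w z : Euc 2) :
    fderiv ℝ (coordMetric G F) y v w z = G (F y) (coordCovDeriv Γ F y v w) (fderiv ℝ F y z)
      + G (F y) (fderiv ℝ F y w) (coordCovDeriv Γ F y v z) := by
  have hdF := h.differentiableAt h.fderiv_smooth hy
  have hdFc : ∀ u, DifferentiableAt ℝ (fun x => fderiv ℝ F x u) y := fun u =>
    hdF.clm_apply (differentiableAt_const u)
  have h1 := fderiv_bilin_const (h.differentiableAt h.coordMetric_smooth hy) v w z
  have h3 : (fun x => coordMetric G F x w z)
      = fun x => G (F x) (fderiv ℝ F x w) (fderiv ℝ F x z) := rfl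
  have h2 := (hasFDerivAt_bilin_apply (h.differentiableAt h.metric_comp_smooth hy)
    (hdFc w) (hdFc z)).2 v
  rw [fderiv_clm_const hdF, fderiv_clm_const hdF, h.fderiv_metric_comp hy,
    h.metric_compatible hy hΓ] at h2
  rw [h1, h3, h2]
  simp only [coordCovDeriv, map_add, _root_.add_apply]
  ring

/-- As for the metric, with `hJ` used to move the covariant derivative past `J_a`; no derivative of
the complex structure remains. -/
lemma fderiv_coordKahler (h : IsCoordImmersion G J W r U F) (hy : y ∈ U)
    (hΓ : ∀ v w z, G (F y) (Γ v w) z = 1 / 2 * (fderiv ℝ G (F y) v w z + fderiv ℝ G (F y) w v z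
      - fderiv ℝ G (F y) z v w))
    (hJ : ∀ a v w, fderiv ℝ (J a) (F y) v w + Γ v (J a (F y) w) - J a (F y) (Γ v w) = 0)
    (a : Fin 3) (v : Euc 2) :
    fderiv ℝ (coordKahler G J F a) y v
      = G (F y) (J a (F y) (coordCovDeriv Γ F y v (basisVec 2 0))) (fderiv ℝ F y (basisVec 2 1))
      + G (F y) (J a (F y) (fderiv ℝ F y (basisVec 2 0)))
        (coordCovDeriv Γ F y v (basisVec 2 1)) := by
  have hdF := h.differentiableAt h.fderiv_smooth hy
  have hdFc : ∀ u, DifferentiableAt ℝ (fun x => fderiv ℝ F x u) y := fun u =>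
    hdF.clm_apply (differentiableAt_const u)
  have hdJ := h.differentiableAt (h.cplx_comp_smooth a) hy
  have h2 := (hasFDerivAt_bilin_apply (h.differentiableAt h.metric_comp_smooth hy)
    (hdJ.clm_apply (hdFc (basisVec 2 0))) (hdFc (basisVec 2 1))).2 v
  have h3 : fderiv ℝ (fun x => J a (F x) (fderiv ℝ F x (basisVec 2 0))) y v
      = J a (F y) (coordCovDeriv Γ F y v (basisVec 2 0))
        - Γ (fderiv ℝ F y v) (J a (F y) (fderiv ℝ F y (basisVec 2 0))) := by
    rw [fderiv_clm_apply hdJ (hdFc _)]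
    simp only [_root_.add_apply, ContinuousLinearMap.comp_apply, ContinuousLinearMap.flip_apply]
    rw [fderiv_clm_const hdF, h.fderiv_cplx_comp hy, coordCovDeriv, map_add]
    have := hJ a (fderiv ℝ F y v) (fderiv ℝ F y (basisVec 2 0))
    rw [sub_eq_zero] at this
    rw [← this]
    abel
  rw [h3, fderiv_clm_const hdF, h.fderiv_metric_comp hy, h.metric_compatible hy hΓ] at h2
  refine h2.trans ?_
  simp only [coordCovDeriv, map_add, map_sub, _root_.add_apply, _root_.sub_apply]
  ring

/-- The normal part of the velocity of the H-flow is `λ² H`. -/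
lemma inner_velocity_normal (h : IsCoordImmersion G J W r U F) (hy : y ∈ U)
    (hΓ : ∀ v w z, G (F y) (Γ v w) z = 1 / 2 * (fderiv ℝ G (F y) v w z + fderiv ℝ G (F y) w v z
      - fderiv ℝ G (F y) z v w))
    (hJ : ∀ a v w, fderiv ℝ (J a) (F y) v w + Γ v (J a (F y) w) - J a (F y) (Γ v w) = 0)
    {η : Fin 3 → Euc 2}
    (hη : ∀ a v, r y * wedge (η a) v = fderiv ℝ (fun x => coordKahler G J F a x / r x) y v)
    {n : Euc 4} (hn : ∀ v, G (F y) (fderiv ℝ F y v) n = 0) :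
    G (F y) (∑ a, J a (F y) (fderiv ℝ F y (η a))) n
      = coordLamSq G r F y *
        metricTrace (coordMetric G F y) fun v w => G (F y) (coordCovDeriv Γ F y v w) n := by
  have hq := h.quaternionic _ (h.mapsTo hy)
  have hr := h.area_ne_zero y hy
  have hdr := h.differentiableAt h.area_smooth hy
  rw [metricTrace_two (h.coordMetric_symm hy), coordLamSq]
  have hdet := (gramDet_pos (h.coordMetric_symm hy) (h.coordMetric_pos hy)).ne'
  set D := fderiv ℝ F y with hD
  set e0 := basisVec 2 0 with he0
  set e1 := basisVec 2 1 with he1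
  have hB : coordMetric G F y = pullForm (G (F y)) D := rfl
  -- From `ω_a = N_a r`: `r dN_a = dω_a - N_a dr`.
  have hdN : ∀ a v, r y * fderiv ℝ (fun x => coordKahler G J F a x / r x) y v
      = fderiv ℝ (coordKahler G J F a) y v - coordKahler G J F a y / r y * fderiv ℝ r y v := by
    intro a v
    have hN : DifferentiableAt ℝ (fun x => coordKahler G J F a x / r x) y :=
      h.differentiableAt ((h.coordKahler_smooth a).div h.area_smooth h.area_ne_zero) hy
    have h1 : coordKahler G J F a =ᶠ[nhds y] fun x => coordKahler G J F a x / r x * r x := by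
      filter_upwards [h.isOpen_source.mem_nhds hy] with x hx
      rw [div_mul_cancel₀ _ (h.area_ne_zero x hx)]
    rw [h1.fderiv_eq, fderiv_fun_mul hN hdr]
    simp
  have hη0 : ∀ a, r y * η a 0 = fderiv ℝ (fun x => coordKahler G J F a x / r x) y e1 := by
    intro a; rw [← hη]; simp [wedge, he1, basisVec]
  have hη1 : ∀ a, r y * η a 1 = - fderiv ℝ (fun x => coordKahler G J F a x / r x) y e0 := by
    intro a; rw [← hη]; simp [wedge, he0, basisVec]
  set d00 := coordCovDeriv Γ F y e0 e0 with h00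
  set d01 := coordCovDeriv Γ F y e0 e1 with h01
  set d11 := coordCovDeriv Γ F y e1 e1 with h11
  have h10 : coordCovDeriv Γ F y e1 e0 = d01 := h.coordCovDeriv_symm hy hΓ _ _
  -- The components of `η_a` are derivatives of `N_a` over `r`. Skewness of `J_a` arranges every
  -- term as a product of two pairings with `J_a (D e0)` or `J_a (D e1)`, the shape that Parseval
  -- sums over `a`.
  have key : ∀ a, r y ^ 2 * G (F y) (J a (F y) (D (η a))) n
      = (G (F y) (J a (F y) (D e0)) d11 * G (F y) (J a (F y) (D e0)) n
        + G (F y) (J a (F y) (D e1)) d00 * G (F y) (J a (F y) (D e1)) n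
        - (G (F y) (J a (F y) (D e0)) d01 * G (F y) (J a (F y) (D e1)) n
          + G (F y) (J a (F y) (D e1)) d01 * G (F y) (J a (F y) (D e0)) n))
        - fderiv ℝ r y e1 / r y *
          (G (F y) (J a (F y) (D e0)) (D e1) * G (F y) (J a (F y) (D e0)) n)
        - fderiv ℝ r y e0 / r y *
          (G (F y) (J a (F y) (D e1)) (D e0) * G (F y) (J a (F y) (D e1)) n) := by
    intro a
    have ha0 := hdN a e0
    have ha1 := hdN a e1
    rw [h.fderiv_coordKahler hy hΓ hJ] at ha0 ha1
    rw [← neg_eq_iff_eq_neg.2 (hη1 a)] at ha0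
    rw [← hη0] at ha1
    rw [← hD, ← he0, ← he1, ← h00, ← h01, hq.skew a d00 (D e1)] at ha0
    rw [← hD, ← he0, ← he1, h10, ← h11, hq.skew a d01 (D e1)] at ha1
    have hK : coordKahler G J F a y = G (F y) (J a (F y) (D e0)) (D e1) := rfl
    rw [hK] at ha0 ha1
    conv_lhs => rw [eq_smul_basisVec (η a)]
    rw [hq.skew a (D e1) (D e0)]
    simp only [map_add, map_smul, _root_.add_apply, _root_.smul_apply, smul_eq_mul]
    linear_combination G (F y) (J a (F y) (D e0)) n * ha1 - G (F y) (J a (F y) (D e1)) n * ha0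
  have hsum := Finset.sum_congr (rfl : (Finset.univ : Finset (Fin 3)) = _) fun a _ => key a
  simp only [Finset.sum_sub_distrib, Finset.sum_add_distrib, ← Finset.mul_sum] at hsum
  -- Since `n` is normal, `p0`, `p1`, `p01` sum the curvature terms to `g₀₀⟨d11,n⟩`, `g₁₁⟨d00,n⟩`,
  -- `2g₀₁⟨d01,n⟩`, whereas `q0` and `q1` show that the contributions of `dr` cancel in the sum.
  have p0 := hq.parseval (D e0) d11 n
  have p1 := hq.parseval (D e1) d00 n
  have p01 := hq.parseval_polar (D e0) (D e1) d01 n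
  have q0 := hq.parseval (D e0) (D e1) n
  have q1 := hq.parseval (D e1) (D e0) n
  simp only [hn, mul_zero, zero_add, sub_zero] at p0 p1 p01 q0 q1
  rw [Finset.sum_add_distrib] at p01
  rw [← q0, ← q1, ← p0, ← p1, p01] at hsum
  rw [map_sum, _root_.sum_apply]
  rw [h10, hB]
  simp only [smul_eq_mul]
  have hBa : ∀ v w, pullForm (G (F y)) D v w = G (F y) (D v) (D w) := fun _ _ => rfl
  simp only [hBa]
  rw [hB] at hdet
  field_simp
  rw [mul_comm, hsum]
  ring

end IsCoordImmersion

/-! ### Second fundamental form and first variation of the metric, in coordinates. -/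

/-- The second fundamental form in coordinates. -/
def coordSecondFF (G : Euc 4 → Euc 4 →L[ℝ] Euc 4 →L[ℝ] ℝ) (Γ : Euc 4 → Euc 4 → Euc 4)
    (F : Euc 2 → Euc 4) (y : Euc 2) (v w : Euc 2) : Euc 4 :=
  coordCovDeriv Γ F y v w - metricTrace (coordMetric G F y) fun a b =>
    G (F y) (coordCovDeriv Γ F y v w) (fderiv ℝ F y a) • fderiv ℝ F y b

/-- The mean curvature vector in coordinates. -/
def coordMeanCurv (G : Euc 4 → Euc 4 →L[ℝ] Euc 4 →L[ℝ] ℝ) (Γ : Euc 4 → Euc 4 → Euc 4)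
    (F : Euc 2 → Euc 4) (y : Euc 2) : Euc 4 :=
  metricTrace (coordMetric G F y) fun a b => coordSecondFF G Γ F y a b

namespace IsCoordImmersion

variable {G : Euc 4 → Euc 4 →L[ℝ] Euc 4 →L[ℝ] ℝ} {J : Fin 3 → Euc 4 → Euc 4 →L[ℝ] Euc 4}
  {W : Set (Euc 4)} {r : Euc 2 → ℝ} {U : Set (Euc 2)} {F : Euc 2 → Euc 4} {y : Euc 2}
  {Γ : Euc 4 → Euc 4 → Euc 4}

/-- The tangential part of the derivative of the coordinate fields is given by any Christoffel
symbols of the induced metric. -/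
lemma coordSecondFF_eq (h : IsCoordImmersion G J W r U F) (hy : y ∈ U)
    (hΓ : ∀ v w z, G (F y) (Γ v w) z = 1 / 2 * (fderiv ℝ G (F y) v w z + fderiv ℝ G (F y) w v z
      - fderiv ℝ G (F y) z v w))
    {γ : Euc 2 → Euc 2 → Euc 2}
    (hγ : ∀ v w z, coordMetric G F y (γ v w) z = 1 / 2 * (fderiv ℝ (coordMetric G F) y v w z
      + fderiv ℝ (coordMetric G F) y w v z - fderiv ℝ (coordMetric G F) y z v w))
    (v w : Euc 2) :
    coordSecondFF G Γ F y v w = coordCovDeriv Γ F y v w - fderiv ℝ F y (γ v w) := by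
  have hq := h.quaternionic _ (h.mapsTo hy)
  set L : Euc 2 →ₗ[ℝ] ℝ :=
    ((G (F y) (coordCovDeriv Γ F y v w)).comp (fderiv ℝ F y)).toLinearMap with hL
  have h1 : (metricTrace (coordMetric G F y) fun a b =>
      G (F y) (coordCovDeriv Γ F y v w) (fderiv ℝ F y a) • fderiv ℝ F y b)
      = fderiv ℝ F y (metricTrace (coordMetric G F y) fun a b => L a • b) := by
    have := map_metricTrace (fderiv ℝ F y).toLinearMap (coordMetric G F y) fun a b => L a • b
    simp only [ContinuousLinearMap.coe_coe, map_smul] at this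
    rw [this]
    rfl
  -- Both vectors represent the linear form `z ↦ ⟨∇_v F_w, F_z⟩`: by torsion-freeness the Koszul
  -- formula for the induced metric collapses to it.
  have h2 : γ v w = metricTrace (coordMetric G F y) fun a b => L a • b := by
    by_contra hne
    refine (h.coordMetric_pos hy _ (sub_ne_zero.2 hne)).ne' ?_
    rw [map_sub (coordMetric G F y), _root_.sub_apply,
      inner_metricTrace_smul (h.coordMetric_pos hy), hγ]
    simp only [h.fderiv_coordMetric hy hΓ]
    generalize γ v w - metricTrace (coordMetric G F y) (fun a b => L a • b) = z
    have hLz : L z = G (F y) (coordCovDeriv Γ F y v w) (fderiv ℝ F y z) := rfl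
    rw [hLz, h.coordCovDeriv_symm hy hΓ w v, h.coordCovDeriv_symm hy hΓ z v,
      h.coordCovDeriv_symm hy hΓ z w, hq.symm (fderiv ℝ F y v) (coordCovDeriv Γ F y w z),
      hq.symm (fderiv ℝ F y w)]
    ring
  rw [coordSecondFF, h1, ← h2]

/-- The Christoffel symbols of the induced metric. -/
def _root_.HFlow.coordChristoffel (g : Euc 2 → Euc 2 →L[ℝ] Euc 2 →L[ℝ] ℝ) (y v w : Euc 2) : Euc 2 :=
  metricTrace (g y) fun a b =>
    (1 / 2 * (fderiv ℝ g y v w a + fderiv ℝ g y w v a - fderiv ℝ g y a v w)) • b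

/-- Raising an index and lowering it again. It supplies the first-kind identities `hΓ` and `hγ` for
the Christoffel symbols of `M` and of the surface. -/
lemma _root_.HFlow.inner_metricTrace_low {n : ℕ} {B : Euc n →L[ℝ] Euc n →L[ℝ] ℝ}
    (hpos : ∀ v, v ≠ 0 → 0 < B v v) (dG : Euc n →L[ℝ] Euc n →L[ℝ] Euc n →L[ℝ] ℝ) (v w z : Euc n) :
    B (metricTrace B fun a b => (1 / 2 * (dG v w a + dG w v a - dG a v w)) • b) z
      = 1 / 2 * (dG v w z + dG w v z - dG z v w) := by
  let L : Euc n →ₗ[ℝ] ℝ :=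
    ((1 / 2 : ℝ) • (dG v w + dG w v - (dG.flip v).flip w)).toLinearMap
  exact inner_metricTrace_smul hpos L z

/-- The subtracted tangential part is given by the Levi-Civita symbols of the induced metric, whose
Koszul formula returns `⟨∇_v F_w, F_z⟩`. -/
lemma coordSecondFF_normal (h : IsCoordImmersion G J W r U F) (hy : y ∈ U)
    (hΓ : ∀ v w z, G (F y) (Γ v w) z = 1 / 2 * (fderiv ℝ G (F y) v w z + fderiv ℝ G (F y) w v z
      - fderiv ℝ G (F y) z v w)) (v w z : Euc 2) :
    G (F y) (fderiv ℝ F y z) (coordSecondFF G Γ F y v w) = 0 := by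
  have hq := h.quaternionic _ (h.mapsTo hy)
  have hγ := inner_metricTrace_low (h.coordMetric_pos hy) (fderiv ℝ (coordMetric G F) y)
  rw [h.coordSecondFF_eq hy hΓ (γ := coordChristoffel (coordMetric G F) y) hγ, map_sub, sub_eq_zero,
    hq.symm _ (fderiv ℝ F y (_))]
  have h1 := hγ v w z
  refine Eq.trans ?_ h1.symm
  simp only [h.fderiv_coordMetric hy hΓ]
  rw [h.coordCovDeriv_symm hy hΓ w v, h.coordCovDeriv_symm hy hΓ z v,
      h.coordCovDeriv_symm hy hΓ z w, hq.symm (fderiv ℝ F y v) (coordCovDeriv Γ F y w z),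
      hq.symm (fderiv ℝ F y w), hq.symm (fderiv ℝ F y z)]
  ring

/-- The first variation of the induced metric under the H-flow. -/
lemma metric_variation (h : IsCoordImmersion G J W r U F) (hy : y ∈ U)
    (hΓ : ∀ v w z, G (F y) (Γ v w) z = 1 / 2 * (fderiv ℝ G (F y) v w z + fderiv ℝ G (F y) w v z
      - fderiv ℝ G (F y) z v w))
    (hJ : ∀ a v w, fderiv ℝ (J a) (F y) v w + Γ v (J a (F y) w) - J a (F y) (Γ v w) = 0)
    {γ : Euc 2 → Euc 2 → Euc 2}
    (hγ : ∀ v w z, coordMetric G F y (γ v w) z = 1 / 2 * (fderiv ℝ (coordMetric G F) y v w z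
      + fderiv ℝ (coordMetric G F) y w v z - fderiv ℝ (coordMetric G F) y z v w))
    {V : Euc 2 → Euc 4} (hVd : DifferentiableAt ℝ V y)
    (hV : ∀ x ∈ U, ∃ η : Fin 3 → Euc 2,
      (∀ a v, r x * wedge (η a) v = fderiv ℝ (fun x => coordKahler G J F a x / r x) x v) ∧
      V x = ∑ a, J a (F x) (fderiv ℝ F x (η a))) (v w : Euc 2) :
    fderiv ℝ G (F y) (V y) (fderiv ℝ F y v) (fderiv ℝ F y w)
        + G (F y) (fderiv ℝ V y v) (fderiv ℝ F y w) + G (F y) (fderiv ℝ F y v) (fderiv ℝ V y w)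
      = fderiv ℝ (fderiv ℝ (coordLamSq G r F)) y v w - fderiv ℝ (coordLamSq G r F) y (γ v w)
        - 2 * coordLamSq G r F y *
          G (F y) (coordMeanCurv G Γ F y) (coordSecondFF G Γ F y v w) := by
  have hq := h.quaternionic _ (h.mapsTo hy)
  have hdF := h.differentiableAt h.fderiv_smooth hy
  have hdu : DifferentiableAt ℝ (fderiv ℝ (coordLamSq G r F)) y :=
    h.differentiableAt (h.coordLamSq_smooth.fderiv_of_isOpen h.isOpen_source (by simp)) hy
  have htan : ∀ x ∈ U, ∀ w, G (F x) (V x) (fderiv ℝ F x w)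
      = 1 / 2 * fderiv ℝ (coordLamSq G r F) x w := by
    intro x hx w
    obtain ⟨η, hη, hη'⟩ := hV x hx
    rw [hη', h.inner_velocity_tangent hx hη]
  have key : ∀ v w, 1 / 2 * fderiv ℝ (fderiv ℝ (coordLamSq G r F)) y v w
      = fderiv ℝ G (F y) (fderiv ℝ F y v) (V y) (fderiv ℝ F y w)
        + G (F y) (fderiv ℝ V y v) (fderiv ℝ F y w)
        + G (F y) (V y) (fderiv ℝ (fderiv ℝ F) y v w) := by
    intro v w
    have h1 := (hasFDerivAt_bilin_apply (h.differentiableAt h.metric_comp_smooth hy) hVd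
      (hdF.clm_apply (differentiableAt_const w))).2 v
    rw [fderiv_clm_const hdF, h.fderiv_metric_comp hy] at h1
    have h2 : (fun x => G (F x) (V x) (fderiv ℝ F x w)) =ᶠ[nhds y]
        fun x => (1 / 2 : ℝ) * fderiv ℝ (coordLamSq G r F) x w := by
      filter_upwards [h.isOpen_source.mem_nhds hy] with x hx using htan x hx w
    rw [h2.fderiv_eq, fderiv_const_mul (hdu.clm_apply (differentiableAt_const w))] at h1
    rw [_root_.smul_apply, fderiv_clm_const hdu] at h1
    exact h1
  -- The second fundamental form is normal, so it sees only the part `λ²H` of `V`; for the same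
  -- reason the tangential part `F_*γ` drops out of the trace.
  have hA : ∀ v w, G (F y) (V y) (coordSecondFF G Γ F y v w)
      = coordLamSq G r F y * G (F y) (coordMeanCurv G Γ F y) (coordSecondFF G Γ F y v w) := by
    intro v w
    obtain ⟨η, hη, hη'⟩ := hV y hy
    rw [hη', h.inner_velocity_normal hy hΓ hJ hη
      (fun z => h.coordSecondFF_normal hy hΓ v w z), coordMeanCurv]
    congr 1
    have := map_metricTrace ((G (F y)).flip (coordSecondFF G Γ F y v w)).toLinearMap
      (coordMetric G F y) fun a b => coordSecondFF G Γ F y a b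
    simp only [ContinuousLinearMap.coe_coe, ContinuousLinearMap.flip_apply] at this
    rw [this]
    congr 1
    funext a b
    rw [h.coordSecondFF_eq hy hΓ hγ a b, map_sub, _root_.sub_apply,
      h.coordSecondFF_normal hy hΓ, sub_zero]
  have h3 := hA v w
  have h4 : G (F y) (V y) (coordSecondFF G Γ F y v w)
      = G (F y) (V y) (fderiv ℝ (fderiv ℝ F) y v w)
        + G (F y) (V y) (Γ (fderiv ℝ F y v) (fderiv ℝ F y w))
        - 1 / 2 * fderiv ℝ (coordLamSq G r F) y (γ v w) := by
    rw [h.coordSecondFF_eq hy hΓ hγ, map_sub, htan y hy, coordCovDeriv, map_add]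
  -- Twice this Koszul formula contains `-dG(V)(F_v, F_w)`, the source of the term in which the
  -- ambient metric is differentiated along the motion.
  have h5 := hΓ (fderiv ℝ F y v) (fderiv ℝ F y w) (V y)
  rw [hq.symm] at h5
  rw [h5, h3] at h4
  have k1 := key v w
  have k2 := key w v
  rw [h.fderiv_fderiv_symm h.coordLamSq_smooth hy w v, h.fderiv_fderiv_symm h.smooth hy w v,
    hq.symm (fderiv ℝ V y w)] at k2
  rw [h.fderiv_metric_symm hy (fderiv ℝ F y v) (V y)] at k1
  rw [h.fderiv_metric_symm hy (fderiv ℝ F y w) (V y)] at k2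
  -- The metric variation is symmetric, so the derivative identity is used for `(v, w)` and `(w,
  -- v)`. The two halves of the second derivative of `λ²` add up, and `h4` converts the rest.
  linear_combination (2 : ℝ) * h4 - k1 - k2

end IsCoordImmersion

/-! ### Charts -/

section Charts

variable {n : ℕ} {N : Type*} [TopologicalSpace N] [ChartedSpace (Euc n) N]
  [IsManifold (𝓡 n) ∞ N]

/-- The differential of the inverse of the chart at `q`. -/
abbrev frameAt (q x : N) : Euc n →L[ℝ] TangentSpace (𝓡 n) x :=
  (trivializationAt (Euc n) (TangentSpace (𝓡 n)) q).symmL ℝ x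

/-- The differential of the chart at `q`. -/
abbrev coframeAt (q x : N) : TangentSpace (𝓡 n) x →L[ℝ] Euc n :=
  (trivializationAt (Euc n) (TangentSpace (𝓡 n)) q).continuousLinearMapAt ℝ x

lemma mem_baseSet_of_mem_source {q x : N} (hx : x ∈ (extChartAt (𝓡 n) q).source) :
    x ∈ (trivializationAt (Euc n) (TangentSpace (𝓡 n)) q).baseSet := by
  rw [TangentBundle.trivializationAt_baseSet]
  simpa using hx

lemma frameAt_coframeAt {q x : N} (hx : x ∈ (extChartAt (𝓡 n) q).source)
    (v : TangentSpace (𝓡 n) x) : frameAt q x (coframeAt q x v) = v :=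
  Trivialization.symmL_continuousLinearMapAt _ (mem_baseSet_of_mem_source hx) v

lemma coframeAt_frameAt {q x : N} (hx : x ∈ (extChartAt (𝓡 n) q).source)
    (v : Euc n) : coframeAt q x (frameAt q x v) = v :=
  Trivialization.continuousLinearMapAt_symmL _ (mem_baseSet_of_mem_source hx) v

lemma frameAt_injective {q x : N} (hx : x ∈ (extChartAt (𝓡 n) q).source) :
    Function.Injective (frameAt (n := n) q x) := fun v w h => by
  rw [← coframeAt_frameAt hx v, h, coframeAt_frameAt hx]

lemma coframeAt_eq {q x : N} (hx : x ∈ (extChartAt (𝓡 n) q).source) (v : TangentSpace (𝓡 n) x) :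
    coframeAt q x v = (trivializationAt (Euc n) (TangentSpace (𝓡 n) : N → Type) q ⟨x, v⟩).2 :=
  congrFun (Trivialization.coe_linearMapAt_of_mem _ (mem_baseSet_of_mem_source hx)) v

/-- The coordinate change of the preferred chart at `q` with itself is the identity at `q`. Hence
quantities at the centre of a chart agree literally with their coordinate versions. -/
lemma frameAt_self (q : N) (v : Euc n) : frameAt q q v = v := by
  rw [frameAt, TangentBundle.symmL_trivializationAt_eq_core (by simp)]
  exact (tangentBundleCore (𝓡 n) N).coordChange_self (achart (Euc n) q) q (mem_chart_source _ q) v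

lemma coframeAt_self (q : N) (v : TangentSpace (𝓡 n) q) : coframeAt q q v = v := by
  rw [coframeAt, TangentBundle.continuousLinearMapAt_trivializationAt_eq_core (by simp)]
  exact (tangentBundleCore (𝓡 n) N).coordChange_self (achart (Euc n) q) q (mem_chart_source _ q) v

lemma chartForm_apply (b : ∀ x : N, TangentSpace (𝓡 n) x →L[ℝ] TangentSpace (𝓡 n) x →L[ℝ] ℝ)
    {q x : N} (hx : x ∈ (extChartAt (𝓡 n) q).source) (v w : Euc n) :
    chartForm b q (extChartAt (𝓡 n) q x) v w = b x (frameAt q x v) (frameAt q x w) := by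
  simp only [chartForm]
  rw [(extChartAt (𝓡 n) q).left_inv hx]
  rfl

lemma chartEnd_apply (A : ∀ x : N, TangentSpace (𝓡 n) x →L[ℝ] TangentSpace (𝓡 n) x)
    {q x : N} (hx : x ∈ (extChartAt (𝓡 n) q).source) (v : Euc n) :
    chartEnd A q (extChartAt (𝓡 n) q x) v = coframeAt q x (A x (frameAt q x v)) := by
  simp only [chartEnd]
  rw [(extChartAt (𝓡 n) q).left_inv hx]
  rfl

lemma contMDiffOn_frameAt (q : N) (v : Euc n) :
    ContMDiffOn (𝓡 n) ((𝓡 n).prod 𝓘(ℝ, Euc n)) ∞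
      (fun x => TotalSpace.mk' (Euc n) (E := (TangentSpace (𝓡 n) : N → Type)) x (frameAt q x v))
      (extChartAt (𝓡 n) q).source := by
  have h1 := (trivializationAt (Euc n) (TangentSpace (𝓡 n) : N → Type) q).contMDiffOn_symmL
    (𝕜 := ℝ) (IB := 𝓡 n) (n := ∞)
  intro x hx
  have h2 := (h1 x (mem_baseSet_of_mem_source hx)).mono
    (fun z (hz : z ∈ (extChartAt (𝓡 n) q).source) => mem_baseSet_of_mem_source hz)
  have h3 : ContMDiffWithinAt (𝓡 n) ((𝓡 n).prod 𝓘(ℝ, Euc n)) ∞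
      (fun x => TotalSpace.mk' (Euc n) (E := Bundle.Trivial N (Euc n)) x v)
      (extChartAt (𝓡 n) q).source x := by
    rw [contMDiffWithinAt_totalSpace]
    exact ⟨contMDiffWithinAt_id, contMDiffWithinAt_const⟩
  exact ContMDiffWithinAt.clm_bundle_apply (E₁ := Bundle.Trivial N (Euc n)) (F₁ := Euc n)
    (v := fun _ => v) h2 h3

lemma contDiffOn_comp_chart_symm {E : Type*} [NormedAddCommGroup E] [NormedSpace ℝ E] {u : N → E}
    {q : N} (hu : ContMDiffOn (𝓡 n) 𝓘(ℝ, E) ∞ u (extChartAt (𝓡 n) q).source) :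
    ContDiffOn ℝ ∞ (fun y => u ((extChartAt (𝓡 n) q).symm y)) (extChartAt (𝓡 n) q).target := by
  rw [← contMDiffOn_iff_contDiffOn]
  exact hu.comp (contMDiffOn_extChartAt_symm q) (fun y hy => (extChartAt (𝓡 n) q).map_target hy)

/-- Smoothness is tested on constant coordinate vectors, whose frame fields are smooth sections; the
components are then smooth scalar functions. -/
lemma chartForm_smooth {b : ∀ x : N, TangentSpace (𝓡 n) x →L[ℝ] TangentSpace (𝓡 n) x →L[ℝ] ℝ}
    (hb : ContMDiff (𝓡 n) ((𝓡 n).prod 𝓘(ℝ, Euc n →L[ℝ] Euc n →L[ℝ] ℝ)) ∞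
      (fun x => TotalSpace.mk' (Euc n →L[ℝ] Euc n →L[ℝ] ℝ)
        (E := fun x : N => TangentSpace (𝓡 n) x →L[ℝ] TangentSpace (𝓡 n) x →L[ℝ] ℝ) x (b x)))
    (q : N) : ContDiffOn ℝ ∞ (chartForm b q) (extChartAt (𝓡 n) q).target := by
  simp only [contDiffOn_clm_apply]
  intro v w
  refine contDiffOn_comp_chart_symm (u := fun x => b x (frameAt q x v) (frameAt q x w)) ?_
  intro x hx
  have h : ContMDiffWithinAt (𝓡 n) ((𝓡 n).prod 𝓘(ℝ, ℝ)) ∞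
      (fun x => TotalSpace.mk' ℝ (E := Bundle.Trivial N ℝ) x
        (b x (frameAt q x v) (frameAt q x w))) (extChartAt (𝓡 n) q).source x := by
    apply ContMDiffWithinAt.clm_bundle_apply₂ (F₁ := Euc n) (F₂ := Euc n)
    · exact (hb x).contMDiffWithinAt
    · exact contMDiffOn_frameAt q v x hx
    · exact contMDiffOn_frameAt q w x hx
  rw [contMDiffWithinAt_totalSpace] at h
  exact h.2

lemma chartEnd_smooth {A : ∀ x : N, TangentSpace (𝓡 n) x →L[ℝ] TangentSpace (𝓡 n) x}
    (hA : ContMDiff (𝓡 n) ((𝓡 n).prod 𝓘(ℝ, Euc n →L[ℝ] Euc n)) ∞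
      (fun x => TotalSpace.mk' (Euc n →L[ℝ] Euc n)
        (E := fun x : N => TangentSpace (𝓡 n) x →L[ℝ] TangentSpace (𝓡 n) x) x (A x)))
    (q : N) : ContDiffOn ℝ ∞ (chartEnd A q) (extChartAt (𝓡 n) q).target := by
  rw [contDiffOn_clm_apply]
  intro v
  refine contDiffOn_comp_chart_symm (u := fun x => coframeAt q x (A x (frameAt q x v))) ?_
  intro x hx
  have h : ContMDiffWithinAt (𝓡 n) ((𝓡 n).prod 𝓘(ℝ, Euc n)) ∞
      (fun x => TotalSpace.mk' (Euc n) (E := (TangentSpace (𝓡 n) : N → Type)) x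
        (A x (frameAt q x v))) (extChartAt (𝓡 n) q).source x := by
    apply ContMDiffWithinAt.clm_bundle_apply (F₁ := Euc n)
    · exact (hA x).contMDiffWithinAt
    · exact contMDiffOn_frameAt q v x hx
  rw [(trivializationAt (Euc n) (TangentSpace (𝓡 n) : N → Type) q).contMDiffWithinAt_iff
    (by exact mem_baseSet_of_mem_source hx)] at h
  exact h.2.congr (fun z hz => coframeAt_eq hz _) (coframeAt_eq hx _)

lemma mdifferentiableAt_chart_symm {q : N} {y : Euc n} (hy : y ∈ (extChartAt (𝓡 n) q).target) :
    MDifferentiableAt 𝓘(ℝ, Euc n) (𝓡 n) (extChartAt (𝓡 n) q).symm y :=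
  (((contMDiffOn_extChartAt_symm (I := 𝓡 n) (n := 1) q) y hy).contMDiffAt
    ((isOpen_extChartAt_target q).mem_nhds hy)).mdifferentiableAt (by simp)

lemma frameAt_eq_mfderiv {q : N} {y : Euc n} (hy : y ∈ (extChartAt (𝓡 n) q).target) :
    frameAt q ((extChartAt (𝓡 n) q).symm y)
      = mfderiv 𝓘(ℝ, Euc n) (𝓡 n) (extChartAt (𝓡 n) q).symm y := by
  rw [frameAt, TangentBundle.symmL_trivializationAt (by
    simpa using (extChartAt (𝓡 n) q).map_target hy), (extChartAt (𝓡 n) q).right_inv hy,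
    ModelWithCorners.range_eq_univ, mfderivWithin_univ]

lemma mfderiv_frameAt {E : Type*} [NormedAddCommGroup E] [NormedSpace ℝ E] {u : N → E} {q : N}
    {y : Euc n} (hy : y ∈ (extChartAt (𝓡 n) q).target)
    (hu : MDifferentiableAt (𝓡 n) 𝓘(ℝ, E) u ((extChartAt (𝓡 n) q).symm y)) (v : Euc n) :
    mfderiv (𝓡 n) 𝓘(ℝ, E) u ((extChartAt (𝓡 n) q).symm y)
        (frameAt q ((extChartAt (𝓡 n) q).symm y) v)
      = fderiv ℝ (fun y => u ((extChartAt (𝓡 n) q).symm y)) y v := by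
  rw [frameAt_eq_mfderiv hy, ← mfderiv_eq_fderiv]
  have := mfderiv_comp y hu (mdifferentiableAt_chart_symm hy)
  exact (congrArg (fun L : Euc n →L[ℝ] E => L v) this).symm

/-- Near the point `u` is `g` composed with the chart, so differentiability of `u` is a consequence.
This is what the functions `N_a` need, since they are known to be smooth only through their
coordinate expressions. -/
lemma mfderiv_frameAt_of_eventuallyEq {E : Type*} [NormedAddCommGroup E] [NormedSpace ℝ E]
    {u : N → E} {g : Euc n → E} {q : N} {y : Euc n} (hy : y ∈ (extChartAt (𝓡 n) q).target)
    (hg : DifferentiableAt ℝ g y)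
    (hu : (fun y => u ((extChartAt (𝓡 n) q).symm y)) =ᶠ[nhds y] g) (v : Euc n) :
    mfderiv (𝓡 n) 𝓘(ℝ, E) u ((extChartAt (𝓡 n) q).symm y)
        (frameAt q ((extChartAt (𝓡 n) q).symm y) v) = fderiv ℝ g y v := by
  have hx := (extChartAt (𝓡 n) q).map_target hy
  have hs : (extChartAt (𝓡 n) q).symm y ∈ (chartAt (Euc n) q).source := by simpa using hx
  have hφ : MDifferentiableAt (𝓡 n) 𝓘(ℝ, Euc n) (extChartAt (𝓡 n) q)
      ((extChartAt (𝓡 n) q).symm y) := mdifferentiableAt_extChartAt hs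
  have hyy := (extChartAt (𝓡 n) q).right_inv hy
  have hd : MDifferentiableAt (𝓡 n) 𝓘(ℝ, E) u ((extChartAt (𝓡 n) q).symm y) := by
    have h1 : MDifferentiableAt (𝓡 n) 𝓘(ℝ, E) (fun x => g (extChartAt (𝓡 n) q x))
        ((extChartAt (𝓡 n) q).symm y) :=
      MDifferentiableAt.comp _ (by rw [hyy]; exact hg.mdifferentiableAt) hφ
    refine h1.congr_of_eventuallyEq ?_
    have h2 : Filter.Tendsto (extChartAt (𝓡 n) q) (nhds ((extChartAt (𝓡 n) q).symm y))
        (nhds y) := by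
      have := (continuousAt_extChartAt' (I := 𝓡 n) hx).tendsto
      rwa [hyy] at this
    filter_upwards [h2 hu, extChartAt_source_mem_nhds' (I := 𝓡 n) hx] with x hx1 hx2
    have : u ((extChartAt (𝓡 n) q).symm (extChartAt (𝓡 n) q x)) = g (extChartAt (𝓡 n) q x) := hx1
    rwa [(extChartAt (𝓡 n) q).left_inv hx2] at this
  rw [mfderiv_frameAt hy hd, hu.fderiv_eq]

lemma coframeAt_mfderiv_frameAt {m : ℕ} {N' : Type*} [TopologicalSpace N'] [ChartedSpace (Euc m) N']
    [IsManifold (𝓡 m) ∞ N'] {f : N → N'} {q : N} {q' : N'}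
    {y : Euc n} (hy : y ∈ (extChartAt (𝓡 n) q).target)
    (hf : MDifferentiableAt (𝓡 n) (𝓡 m) f ((extChartAt (𝓡 n) q).symm y))
    (hq' : f ((extChartAt (𝓡 n) q).symm y) ∈ (extChartAt (𝓡 m) q').source) (v : Euc n) :
    coframeAt q' (f ((extChartAt (𝓡 n) q).symm y))
        (mfderiv (𝓡 n) (𝓡 m) f ((extChartAt (𝓡 n) q).symm y)
          (frameAt q ((extChartAt (𝓡 n) q).symm y) v))
      = fderiv ℝ (fun y => extChartAt (𝓡 m) q' (f ((extChartAt (𝓡 n) q).symm y))) y v := by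
  have hs : f ((extChartAt (𝓡 n) q).symm y) ∈ (chartAt (Euc m) q').source := by simpa using hq'
  have hφ : MDifferentiableAt (𝓡 m) 𝓘(ℝ, Euc m) (extChartAt (𝓡 m) q')
      (f ((extChartAt (𝓡 n) q).symm y)) := mdifferentiableAt_extChartAt hs
  rw [coframeAt, TangentBundle.continuousLinearMapAt_trivializationAt hs,
    ← mfderiv_frameAt (u := fun x => extChartAt (𝓡 m) q' (f x)) hy (hφ.comp _ hf)]
  have := mfderiv_comp ((extChartAt (𝓡 n) q).symm y) hφ hf
  exact (congrArg (fun L : Euc n →L[ℝ] Euc m =>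
    L (frameAt q ((extChartAt (𝓡 n) q).symm y) v)) this).symm

end Charts

/-! ### Product neighbourhoods on which the flow is a smooth map between coordinate domains. -/

section Flow

variable {S M : Type*} [TopologicalSpace S] [ChartedSpace (Euc 2) S] [IsManifold (𝓡 2) ∞ S]
  [TopologicalSpace M] [ChartedSpace (Euc 4) M] [IsManifold (𝓡 4) ∞ M]
  {𝓗 : HyperKahler M} {ρ : AreaForm S} {τ : Set ℝ} {f : ℝ → S → M} {t₀ : ℝ} {x₀ : S}

/-- The family `f` in the charts at `x` and `q`. -/
def coordFamily (f : ℝ → S → M) (x : S) (q : M) (z : ℝ × Euc 2) : Euc 4 :=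
  extChartAt (𝓡 4) q (f z.1 ((extChartAt (𝓡 2) x).symm z.2))

/-- The coefficient of `ρ` in the chart at `x`. -/
def coordArea (ρ : AreaForm S) (x : S) (y : Euc 2) : ℝ :=
  chartForm ρ.form x y (basisVec 2 0) (basisVec 2 1)

/-- Neighbourhoods of `t₀` in `τ` and of `x₀` in its chart on which `f` takes values in the chart
at `f t₀ x₀`. -/
structure IsFlowChart (τ : Set ℝ) (f : ℝ → S → M) (t₀ : ℝ) (x₀ : S) (T : Set ℝ)
    (U : Set (Euc 2)) : Prop where
  subset : T ⊆ τ
  mem_nhdsWithin : T ∈ nhdsWithin t₀ τ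
  mem_time : t₀ ∈ T
  convex : Convex ℝ T
  interior_nonempty : (interior T).Nonempty
  isOpen : IsOpen U
  mem_space : extChartAt (𝓡 2) x₀ x₀ ∈ U
  subset_target : U ⊆ (extChartAt (𝓡 2) x₀).target
  mapsTo : ∀ s ∈ T, ∀ y ∈ U,
    f s ((extChartAt (𝓡 2) x₀).symm y) ∈ (extChartAt (𝓡 4) (f t₀ x₀)).source
  smooth : ContDiffOn ℝ ∞ (coordFamily f x₀ (f t₀ x₀)) (T ×ˢ U)

/-- A time interval shrunk around `t₀` must keep nonempty interior, for derivatives within it to be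
unique. Truncating the distance to a second point of `τ` at `ε / 2` gives a second point in the
ball, even when `t₀` is an endpoint. -/
lemma nontrivial_inter_ball (hτ : τ.OrdConnected) (hτ' : τ.Nontrivial) (ht₀ : t₀ ∈ τ) {ε : ℝ}
    (hε : 0 < ε) : (τ ∩ Metric.ball t₀ ε).Nontrivial := by
  obtain ⟨s, hs, hne⟩ := hτ'.exists_ne t₀
  rcases lt_or_gt_of_ne hne with h | h
  · refine ⟨t₀, ⟨ht₀, Metric.mem_ball_self hε⟩, max s (t₀ - ε / 2),
      ⟨hτ.out hs ht₀ ⟨le_max_left _ _, max_le h.le (by linarith)⟩, ?_⟩, ?_⟩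
    · rw [Real.ball_eq_Ioo]
      exact ⟨lt_max_of_lt_right (by linarith), max_lt (by linarith) (by linarith)⟩
    · exact (max_lt h (by linarith)).ne'
  · refine ⟨t₀, ⟨ht₀, Metric.mem_ball_self hε⟩, min s (t₀ + ε / 2),
      ⟨hτ.out ht₀ hs ⟨le_min h.le (by linarith), min_le_left _ _⟩, ?_⟩, ?_⟩
    · rw [Real.ball_eq_Ioo]
      exact ⟨lt_min (by linarith) (by linarith), min_lt_of_right_lt (by linarith)⟩
    · exact (lt_min h (by linarith)).ne

lemma contMDiffOn_flow_chart_symm (hf : IsHFlow 𝓗 ρ τ f) (x₀ : S) :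
    ContMDiffOn (𝓘(ℝ, ℝ).prod 𝓘(ℝ, Euc 2)) (𝓡 4) ∞
      (fun z : ℝ × Euc 2 => f z.1 ((extChartAt (𝓡 2) x₀).symm z.2))
      (τ ×ˢ (extChartAt (𝓡 2) x₀).target) := by
  have h1 : ContMDiffOn (𝓘(ℝ, ℝ).prod 𝓘(ℝ, Euc 2)) (𝓘(ℝ, ℝ).prod (𝓡 2)) ∞
      (Prod.map (id : ℝ → ℝ) (extChartAt (𝓡 2) x₀).symm)
      (τ ×ˢ (extChartAt (𝓡 2) x₀).target) :=
    contMDiffOn_id.prodMap (contMDiffOn_extChartAt_symm x₀)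
  exact hf.smooth.comp h1 (fun z hz => ⟨hz.1, trivial⟩)

/-- Joint continuity at `(t₀, x₀)` keeps `f` inside one chart of `M` on a product neighbourhood. -/
lemma exists_isFlowChart (hτ : τ.OrdConnected) (hτ' : τ.Nontrivial) (hf : IsHFlow 𝓗 ρ τ f)
    (ht₀ : t₀ ∈ τ) (x₀ : S) : ∃ T U, IsFlowChart τ f t₀ x₀ T U := by
  have h1 := contMDiffOn_flow_chart_symm hf x₀
  set ψ := extChartAt (𝓡 2) x₀ with hψ
  set φ := extChartAt (𝓡 4) (f t₀ x₀) with hφ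
  have hy₀ : ψ x₀ ∈ ψ.target := mem_extChartAt_target x₀
  have h2 := h1.continuousOn (t₀, ψ x₀) ⟨ht₀, hy₀⟩
  have h3 : φ.source ∈ nhds (f t₀ (ψ.symm (ψ x₀))) := by
    rw [hψ, extChartAt_to_inv]
    exact extChartAt_source_mem_nhds (I := 𝓡 4) (f t₀ x₀)
  have h4 := h2 h3
  rw [Filter.mem_map, nhdsWithin_prod_eq, Filter.mem_prod_iff] at h4
  obtain ⟨s₁, hs₁, s₂, hs₂, hsub⟩ := h4
  obtain ⟨ε, hε, hε'⟩ := Metric.mem_nhdsWithin_iff.1 hs₁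
  obtain ⟨δ, hδ, hδ'⟩ := Metric.mem_nhdsWithin_iff.1 hs₂
  have hconv : Convex ℝ (τ ∩ Metric.ball t₀ ε) := hτ.convex.inter (convex_ball t₀ ε)
  have hmaps : ∀ s ∈ τ ∩ Metric.ball t₀ ε, ∀ y ∈ Metric.ball (ψ x₀) δ ∩ ψ.target,
      f s (ψ.symm y) ∈ φ.source := fun s hs y hy =>
    hsub (show (s, y) ∈ s₁ ×ˢ s₂ from ⟨hε' ⟨hs.2, hs.1⟩, hδ' hy⟩)
  refine ⟨τ ∩ Metric.ball t₀ ε, Metric.ball (ψ x₀) δ ∩ ψ.target, inter_subset_left,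
    Filter.inter_mem self_mem_nhdsWithin (mem_nhdsWithin_of_mem_nhds (Metric.ball_mem_nhds _ hε)),
    ⟨ht₀, Metric.mem_ball_self hε⟩, hconv, ?_,
    Metric.isOpen_ball.inter (isOpen_extChartAt_target x₀), ⟨Metric.mem_ball_self hδ, hy₀⟩,
    inter_subset_right, hmaps, ?_⟩
  · obtain ⟨a, ha, b, hb, hab⟩ := (nontrivial_inter_ball hτ hτ' ht₀ hε).exists_lt
    refine ⟨(a + b) / 2, ?_⟩
    rw [mem_interior]
    refine ⟨Ioo a b, fun c hc => hconv.ordConnected.out ha hb ⟨hc.1.le, hc.2.le⟩, isOpen_Ioo,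
      by constructor <;> linarith⟩
  · have h5 : ContMDiffOn (𝓘(ℝ, ℝ).prod 𝓘(ℝ, Euc 2)) 𝓘(ℝ, Euc 4) ∞ (coordFamily f x₀ (f t₀ x₀))
        ((τ ∩ Metric.ball t₀ ε) ×ˢ (Metric.ball (ψ x₀) δ ∩ ψ.target)) :=
      (contMDiffOn_extChartAt (I := 𝓡 4) (x := f t₀ x₀)).comp
        (h1.mono (prod_mono inter_subset_left inter_subset_right))
        (fun z hz => by
          have := hmaps z.1 hz.1 z.2 hz.2
          rwa [hφ, extChartAt_source] at this)
    rw [← modelWithCornersSelf_prod, chartedSpaceSelf_prod] at h5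
    exact contMDiffOn_iff_contDiffOn.1 h5

end Flow

section Flow

variable {S M : Type*} [TopologicalSpace S] [ChartedSpace (Euc 2) S] [IsManifold (𝓡 2) ∞ S]
  [TopologicalSpace M] [ChartedSpace (Euc 4) M] [IsManifold (𝓡 4) ∞ M]
  {𝓗 : HyperKahler M} {ρ : AreaForm S} {τ : Set ℝ} {f : ℝ → S → M} {t₀ : ℝ} {x₀ : S}

lemma HyperKahler.isQuaternionic_chart (𝓗 : HyperKahler M) (q : M) {z : Euc 4}
    (hz : z ∈ (extChartAt (𝓡 4) q).target) :
    IsQuaternionic (chartForm 𝓗.metric.inner q z) (fun a => chartEnd (𝓗.cplx a) q z) := by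
  obtain ⟨x, hx, rfl⟩ : ∃ x ∈ (extChartAt (𝓡 4) q).source, extChartAt (𝓡 4) q x = z :=
    ⟨_, (extChartAt (𝓡 4) q).map_target hz, (extChartAt (𝓡 4) q).right_inv hz⟩
  constructor
  · intro v w
    rw [chartForm_apply _ hx, chartForm_apply _ hx, 𝓗.metric.symm]
  · intro v hv
    rw [chartForm_apply _ hx]
    exact 𝓗.metric.pos x _ (fun h => hv (frameAt_injective hx (h.trans (map_zero _).symm)))
  · intro a v
    rw [chartEnd_apply _ hx, chartEnd_apply _ hx, frameAt_coframeAt hx, 𝓗.sq, map_neg,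
      coframeAt_frameAt hx]
  · intro v
    rw [chartEnd_apply _ hx, chartEnd_apply _ hx, chartEnd_apply _ hx, frameAt_coframeAt hx,
      𝓗.quat]
  · intro a v w
    rw [chartForm_apply _ hx, chartForm_apply _ hx, chartEnd_apply _ hx, chartEnd_apply _ hx,
      frameAt_coframeAt hx, frameAt_coframeAt hx, 𝓗.orthogonal]

lemma coordArea_ne_zero (ρ : AreaForm S) {x x' : S} (hx : x' ∈ (extChartAt (𝓡 2) x).source) :
    coordArea ρ x (extChartAt (𝓡 2) x x') ≠ 0 := by
  intro h
  apply ρ.nonvanishing x'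
  ext v w
  have h1 := alternating_apply (B := chartForm ρ.form x (extChartAt (𝓡 2) x x'))
    (fun v => by rw [chartForm_apply _ hx]; exact ρ.alternating _ _)
    (coframeAt x x' v) (coframeAt x x' w)
  rw [coordArea] at h
  rw [h, mul_zero, chartForm_apply _ hx, frameAt_coframeAt hx, frameAt_coframeAt hx] at h1
  exact h1

lemma IsHFlow.mdifferentiableAt (hf : IsHFlow 𝓗 ρ τ f) {t : ℝ} (ht : t ∈ τ) (x : S) :
    MDifferentiableAt (𝓡 2) (𝓡 4) (f t) x := by
  have h1 : ContMDiffOn (𝓡 2) (𝓘(ℝ, ℝ).prod (𝓡 2)) ∞ (fun y : S => (t, y)) univ :=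
    (contMDiff_const.prodMk contMDiff_id).contMDiffOn
  have h2 := hf.smooth.comp h1 (fun y _ => ⟨ht, trivial⟩)
  exact ((contMDiffOn_univ.1 h2) x).mdifferentiableAt (by simp)

namespace IsFlowChart

variable {T : Set ℝ} {U : Set (Euc 2)} {s : ℝ} {y : Euc 2}

lemma mem_source (h : IsFlowChart τ f t₀ x₀ T U) (hy : y ∈ U) :
    (extChartAt (𝓡 2) x₀).symm y ∈ (extChartAt (𝓡 2) x₀).source :=
  (extChartAt (𝓡 2) x₀).map_target (h.subset_target hy)

lemma mfderiv_frame (h : IsFlowChart τ f t₀ x₀ T U) (hf : IsHFlow 𝓗 ρ τ f) (hs : s ∈ T)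
    (hy : y ∈ U) (v : Euc 2) :
    mfderiv (𝓡 2) (𝓡 4) (f s) ((extChartAt (𝓡 2) x₀).symm y)
        (frameAt x₀ ((extChartAt (𝓡 2) x₀).symm y) v)
      = frameAt (f t₀ x₀) (f s ((extChartAt (𝓡 2) x₀).symm y))
        (fderiv ℝ (fun y => coordFamily f x₀ (f t₀ x₀) (s, y)) y v) := by
  have h1 := coframeAt_mfderiv_frameAt (h.subset_target hy)
    (hf.mdifferentiableAt (h.subset hs) _) (h.mapsTo s hs y hy) v
  have h2 := congrArg (frameAt (f t₀ x₀) (f s ((extChartAt (𝓡 2) x₀).symm y))) h1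
  rw [frameAt_coframeAt (h.mapsTo s hs y hy)] at h2
  exact h2

lemma slice_smooth (h : IsFlowChart τ f t₀ x₀ T U) (hs : s ∈ T) :
    ContDiffOn ℝ ∞ (fun y => coordFamily f x₀ (f t₀ x₀) (s, y)) U :=
  h.smooth.comp (contDiffOn_const.prodMk contDiffOn_id) (fun _ hy => ⟨hs, hy⟩)

/-- The coordinate expression of the immersion `f s`. -/
lemma isCoordImmersion (h : IsFlowChart τ f t₀ x₀ T U) (hf : IsHFlow 𝓗 ρ τ f) (hs : s ∈ T) :
    IsCoordImmersion (chartForm 𝓗.metric.inner (f t₀ x₀))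
      (fun a => chartEnd (𝓗.cplx a) (f t₀ x₀)) (extChartAt (𝓡 4) (f t₀ x₀)).target
      (coordArea ρ x₀) U (fun y => coordFamily f x₀ (f t₀ x₀) (s, y)) where
  isOpen_target := isOpen_extChartAt_target _
  isOpen_source := h.isOpen
  metric_smooth := chartForm_smooth 𝓗.metric.contMDiff _
  cplx_smooth a := chartEnd_smooth (𝓗.smooth a) _
  quaternionic z hz := 𝓗.isQuaternionic_chart _ hz
  area_smooth := (((chartForm_smooth ρ.smooth x₀).mono h.subset_target).clm_apply
    contDiffOn_const).clm_apply contDiffOn_const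
  area_ne_zero y hy := by
    have := coordArea_ne_zero ρ (h.mem_source hy)
    rwa [(extChartAt (𝓡 2) x₀).right_inv (h.subset_target hy)] at this
  smooth := h.slice_smooth hs
  mapsTo y hy := (extChartAt (𝓡 4) (f t₀ x₀)).map_source (h.mapsTo s hs y hy)
  injective y hy := by
    intro v w hvw
    have h1 := h.mfderiv_frame hf hs hy v
    rw [hvw, ← h.mfderiv_frame hf hs hy w] at h1
    exact frameAt_injective (h.mem_source hy) (hf.immersion s (h.subset hs) _ h1)

lemma inducedMetric_frame (h : IsFlowChart τ f t₀ x₀ T U) (hf : IsHFlow 𝓗 ρ τ f) (hs : s ∈ T)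
    (hy : y ∈ U) (v w : Euc 2) :
    inducedMetric 𝓗 (f s) ((extChartAt (𝓡 2) x₀).symm y)
        (frameAt x₀ ((extChartAt (𝓡 2) x₀).symm y) v)
        (frameAt x₀ ((extChartAt (𝓡 2) x₀).symm y) w)
      = coordMetric (chartForm 𝓗.metric.inner (f t₀ x₀))
        (fun y => coordFamily f x₀ (f t₀ x₀) (s, y)) y v w := by
  have h1 : inducedMetric 𝓗 (f s) ((extChartAt (𝓡 2) x₀).symm y)
        (frameAt x₀ ((extChartAt (𝓡 2) x₀).symm y) v)
        (frameAt x₀ ((extChartAt (𝓡 2) x₀).symm y) w)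
      = 𝓗.metric.inner (f s ((extChartAt (𝓡 2) x₀).symm y))
        (mfderiv (𝓡 2) (𝓡 4) (f s) ((extChartAt (𝓡 2) x₀).symm y)
          (frameAt x₀ ((extChartAt (𝓡 2) x₀).symm y) v))
        (mfderiv (𝓡 2) (𝓡 4) (f s) ((extChartAt (𝓡 2) x₀).symm y)
          (frameAt x₀ ((extChartAt (𝓡 2) x₀).symm y) w)) := rfl
  rw [h1, h.mfderiv_frame hf hs hy, h.mfderiv_frame hf hs hy]
  exact (chartForm_apply 𝓗.metric.inner (h.mapsTo s hs y hy) _ _).symm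

end IsFlowChart

end Flow

/-! ### Basis independence of `λ` and `N_a`, and the flow equation in a fixed chart. -/

section Flow

variable {S M : Type*} [TopologicalSpace S] [ChartedSpace (Euc 2) S] [IsManifold (𝓡 2) ∞ S]
  [TopologicalSpace M] [ChartedSpace (Euc 4) M] [IsManifold (𝓡 4) ∞ M]
  {𝓗 : HyperKahler M} {ρ : AreaForm S} {τ : Set ℝ} {f : ℝ → S → M} {t₀ : ℝ} {x₀ : S}

lemma AreaForm.apply_eq (ρ : AreaForm S) (x : S) (v w : Euc 2) :
    ρ.form x v w = wedge v w * ρ.form x (basisVec 2 0) (basisVec 2 1) :=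
  alternating_apply (B := ρ.form x) (ρ.alternating x) v w

lemma AreaForm.basis_ne_zero (ρ : AreaForm S) (x : S) :
    ρ.form x (basisVec 2 0) (basisVec 2 1) ≠ 0 := by
  intro h
  apply ρ.nonvanishing x
  ext v w
  have := ρ.apply_eq x v w
  rw [h, mul_zero] at this
  exact this

lemma inducedMetric_symm (𝓗 : HyperKahler M) (g : S → M) (x : S) (v w : Euc 2) :
    inducedMetric 𝓗 g x v w = inducedMetric 𝓗 g x w v :=
  𝓗.metric.symm _ _ _

lemma inducedMetric_pos (𝓗 : HyperKahler M) {g : S → M} {x : S}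
    (hg : Function.Injective (mfderiv (𝓡 2) (𝓡 4) g x)) (v : Euc 2) (hv : v ≠ 0) :
    0 < inducedMetric 𝓗 g x v v :=
  𝓗.metric.pos _ _ (fun h => hv (hg (h.trans (map_zero _).symm)))

/-- The signed square root is a genuine 2-form because `sign(c)·|c| = c` for the determinant `c =
wedge v w`. -/
lemma inducedArea_apply (𝓗 : HyperKahler M) (ρ : AreaForm S) (g : S → M) (x : S) (v w : Euc 2) :
    inducedArea 𝓗 ρ g x v w = wedge v w * inducedArea 𝓗 ρ g x (basisVec 2 0) (basisVec 2 1) := by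
  have h1 := gramDet_apply (B := inducedMetric 𝓗 g x) (inducedMetric_symm 𝓗 g x) v w
  have h2 := ρ.apply_eq x v w
  simp only [inducedArea]
  refine (congrArg₂ (fun a b : ℝ => (SignType.sign a : ℝ) * Real.sqrt b) h2 h1).trans ?_
  have h3 : inducedMetric 𝓗 g x (basisVec 2 0) (basisVec 2 0) *
      inducedMetric 𝓗 g x (basisVec 2 1) (basisVec 2 1)
      - inducedMetric 𝓗 g x (basisVec 2 0) (basisVec 2 1) ^ 2
      = gramDet (inducedMetric 𝓗 g x) := rfl
  refine Eq.trans ?_ (congrArg (fun b : ℝ => wedge v w *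
    ((SignType.sign (ρ.form x (basisVec 2 0) (basisVec 2 1)) : ℝ) * Real.sqrt b)) h3.symm)
  rw [sign_mul, Real.sqrt_mul (sq_nonneg _), Real.sqrt_sq_eq_abs, SignType.coe_mul]
  rw [mul_mul_mul_comm, sign_mul_abs]

/-- `λ² = det g / ρ₁₂²`. -/
lemma lam_sq_eq (𝓗 : HyperKahler M) (ρ : AreaForm S) {g : S → M} {x : S}
    (hg : Function.Injective (mfderiv (𝓡 2) (𝓡 4) g x)) :
    lam 𝓗 ρ g x ^ 2 = gramDet (inducedMetric 𝓗 g x)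
      / (ρ.form x (basisVec 2 0) (basisVec 2 1)) ^ 2 := by
  have h0 := gramDet_pos (B := inducedMetric 𝓗 g x) (inducedMetric_symm 𝓗 g x)
    (inducedMetric_pos 𝓗 hg)
  have h1 : lam 𝓗 ρ g x = (SignType.sign (ρ.form x (basisVec 2 0) (basisVec 2 1)) : ℝ) *
    Real.sqrt (gramDet (inducedMetric 𝓗 g x)) / ρ.form x (basisVec 2 0) (basisVec 2 1) := rfl
  rw [h1, div_pow, mul_pow, Real.sq_sqrt h0.le]
  have h2 := ρ.basis_ne_zero x
  rcases lt_or_gt_of_ne h2 with h | h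
  · rw [sign_neg h]; simp
  · rw [sign_pos h]; simp

lemma cplx_self (𝓗 : HyperKahler M) (a : Fin 3) (z : M) (v : TangentSpace (𝓡 4) z) :
    𝓗.metric.inner z (𝓗.cplx a z v) v = 0 := by
  have h := 𝓗.orthogonal a z (𝓗.cplx a z v) v
  rw [𝓗.sq, map_neg, _root_.neg_apply] at h
  have h' := 𝓗.metric.symm z (𝓗.cplx a z v) v
  linarith

/-- `momentFn` uses the basis of the preferred chart at `x`, which need not vary continuously with
`x`. Numerator and denominator scale by the same determinant, so the frame of a fixed chart may be
used instead. -/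
lemma momentFn_eq (𝓗 : HyperKahler M) (ρ : AreaForm S) (g : S → M) (a : Fin 3) (x : S)
    {v w : Euc 2} (hvw : wedge v w ≠ 0) :
    momentFn 𝓗 ρ g a x = kahlerForm 𝓗 a (g x) (mfderiv (𝓡 2) (𝓡 4) g x v)
      (mfderiv (𝓡 2) (𝓡 4) g x w) / ρ.form x v w := by
  have h1 := alternating_apply (B := pullForm ((𝓗.metric.inner (g x)).comp (𝓗.cplx a (g x)))
    (mfderiv (𝓡 2) (𝓡 4) g x)) (fun v => cplx_self 𝓗 a (g x) _) v w
  have h2 := ρ.apply_eq x v w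
  refine Eq.trans ?_ (congrArg₂ (fun a b : ℝ => a / b) h1 h2).symm
  exact (mul_div_mul_left _ _ hvw).symm

namespace IsFlowChart

variable {T : Set ℝ} {U : Set (Euc 2)} {s : ℝ} {y : Euc 2}

lemma wedge_frame_ne_zero (h : IsFlowChart τ f t₀ x₀ T U) (hy : y ∈ U) :
    wedge (frameAt x₀ ((extChartAt (𝓡 2) x₀).symm y) (basisVec 2 0))
      (frameAt x₀ ((extChartAt (𝓡 2) x₀).symm y) (basisVec 2 1)) ≠ 0 :=
  wedge_ne_zero (D := frameAt x₀ ((extChartAt (𝓡 2) x₀).symm y))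
    (frameAt_injective (h.mem_source hy))

lemma coordArea_eq (h : IsFlowChart τ f t₀ x₀ T U) (ρ : AreaForm S) (hy : y ∈ U) :
    coordArea ρ x₀ y = ρ.form ((extChartAt (𝓡 2) x₀).symm y)
      (frameAt x₀ ((extChartAt (𝓡 2) x₀).symm y) (basisVec 2 0))
      (frameAt x₀ ((extChartAt (𝓡 2) x₀).symm y) (basisVec 2 1)) := by
  rw [← chartForm_apply ρ.form (h.mem_source hy), (extChartAt (𝓡 2) x₀).right_inv
    (h.subset_target hy)]
  rfl

lemma lam_sq (h : IsFlowChart τ f t₀ x₀ T U) (hf : IsHFlow 𝓗 ρ τ f) (hs : s ∈ T) (hy : y ∈ U) :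
    lam 𝓗 ρ (f s) ((extChartAt (𝓡 2) x₀).symm y) ^ 2
      = coordLamSq (chartForm 𝓗.metric.inner (f t₀ x₀)) (coordArea ρ x₀)
        (fun y => coordFamily f x₀ (f t₀ x₀) (s, y)) y := by
  rw [lam_sq_eq 𝓗 ρ (hf.immersion s (h.subset hs) _), coordLamSq, h.coordArea_eq ρ hy, gramDet,
    ← h.inducedMetric_frame hf hs hy, ← h.inducedMetric_frame hf hs hy,
    ← h.inducedMetric_frame hf hs hy]
  have h1 := gramDet_apply (B := inducedMetric 𝓗 (f s) ((extChartAt (𝓡 2) x₀).symm y))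
    (inducedMetric_symm 𝓗 _ _) (frameAt x₀ ((extChartAt (𝓡 2) x₀).symm y) (basisVec 2 0))
      (frameAt x₀ ((extChartAt (𝓡 2) x₀).symm y) (basisVec 2 1))
  have h2 := ρ.apply_eq ((extChartAt (𝓡 2) x₀).symm y)
    (frameAt x₀ ((extChartAt (𝓡 2) x₀).symm y) (basisVec 2 0))
    (frameAt x₀ ((extChartAt (𝓡 2) x₀).symm y) (basisVec 2 1))
  refine Eq.trans ?_ (congrArg₂ (fun a b : ℝ => a / b ^ 2) h1 h2).symm
  simp only [mul_pow]
  exact (mul_div_mul_left _ _ (pow_ne_zero 2 (h.wedge_frame_ne_zero hy))).symm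

lemma momentFn_eq (h : IsFlowChart τ f t₀ x₀ T U) (hf : IsHFlow 𝓗 ρ τ f) (hs : s ∈ T)
    (hy : y ∈ U) (a : Fin 3) :
    momentFn 𝓗 ρ (f s) a ((extChartAt (𝓡 2) x₀).symm y)
      = coordKahler (chartForm 𝓗.metric.inner (f t₀ x₀))
          (fun a => chartEnd (𝓗.cplx a) (f t₀ x₀))
          (fun y => coordFamily f x₀ (f t₀ x₀) (s, y)) a y / coordArea ρ x₀ y := by
  rw [HFlow.momentFn_eq 𝓗 ρ (f s) a _ (h.wedge_frame_ne_zero hy), h.coordArea_eq ρ hy,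
    h.mfderiv_frame hf hs hy, h.mfderiv_frame hf hs hy]
  congr 1
  have hm := h.mapsTo s hs y hy
  rw [coordKahler]
  simp only [coordFamily]
  rw [chartForm_apply _ hm, chartEnd_apply _ hm, frameAt_coframeAt hm]
  rfl

/-- The flow equation in coordinates. -/
lemma exists_velocity (h : IsFlowChart τ f t₀ x₀ T U) (hf : IsHFlow 𝓗 ρ τ f) (hs : s ∈ T)
    (hy : y ∈ U) :
    ∃ η : Fin 3 → Euc 2,
      (∀ a v, coordArea ρ x₀ y * wedge (η a) v
        = fderiv ℝ (fun x => coordKahler (chartForm 𝓗.metric.inner (f t₀ x₀))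
          (fun a => chartEnd (𝓗.cplx a) (f t₀ x₀))
          (fun y => coordFamily f x₀ (f t₀ x₀) (s, y)) a x / coordArea ρ x₀ x) y v) ∧
      HasDerivWithinAt (fun s => coordFamily f x₀ (f t₀ x₀) (s, y))
        (∑ a, chartEnd (𝓗.cplx a) (f t₀ x₀) (coordFamily f x₀ (f t₀ x₀) (s, y))
          (fderiv ℝ (fun y => coordFamily f x₀ (f t₀ x₀) (s, y)) y (η a))) T s := by
  obtain ⟨ξ, hξ, hder⟩ := hf.flow s (h.subset hs) ((extChartAt (𝓡 2) x₀).symm y)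
  have hI := h.isCoordImmersion hf hs
  have hm := h.mapsTo s hs y hy
  -- The coordinates of the Hamiltonian vector fields in the fixed chart at `x₀`.
  refine ⟨fun a => coframeAt x₀ ((extChartAt (𝓡 2) x₀).symm y) (ξ a), ?_, ?_⟩
  · intro a v
    have h1 := hξ a (frameAt x₀ ((extChartAt (𝓡 2) x₀).symm y) v)
    rw [mfderiv_frameAt_of_eventuallyEq (h.subset_target hy)
      (hI.differentiableAt ((hI.coordKahler_smooth a).div hI.area_smooth hI.area_ne_zero) hy)
      (by filter_upwards [h.isOpen.mem_nhds hy] with z hz using h.momentFn_eq hf hs hz a)] at h1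
    refine Eq.trans ?_ h1
    have h2 := chartForm_apply ρ.form (h.mem_source hy)
      (coframeAt x₀ ((extChartAt (𝓡 2) x₀).symm y) (ξ a)) v
    rw [frameAt_coframeAt (h.mem_source hy), (extChartAt (𝓡 2) x₀).right_inv
      (h.subset_target hy)] at h2
    rw [← h2, coordArea, mul_comm]
    refine (alternating_apply (fun v => ?_) _ _).symm
    have h3 := chartForm_apply ρ.form (h.mem_source hy) v v
    rw [(extChartAt (𝓡 2) x₀).right_inv (h.subset_target hy), ρ.alternating] at h3
    exact h3
  · have hsrc : f s ((extChartAt (𝓡 2) x₀).symm y) ∈ (chartAt (Euc 4) (f t₀ x₀)).source := by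
      simpa using hm
    have hφ : MDifferentiableAt (𝓡 4) 𝓘(ℝ, Euc 4) (extChartAt (𝓡 4) (f t₀ x₀))
      (f s ((extChartAt (𝓡 2) x₀).symm y)) := mdifferentiableAt_extChartAt hsrc
    have h1 := hφ.hasMFDerivAt.comp_hasMFDerivWithinAt s (hder.mono h.subset)
    rw [← TangentBundle.continuousLinearMapAt_trivializationAt hsrc] at h1
    have h2 : HasFDerivWithinAt (fun s => coordFamily f x₀ (f t₀ x₀) (s, y))
      (ContinuousLinearMap.toSpanSingleton ℝ
        (coframeAt (f t₀ x₀) (f s ((extChartAt (𝓡 2) x₀).symm y))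
          (∑ a, 𝓗.cplx a (f s ((extChartAt (𝓡 2) x₀).symm y))
            (mfderiv (𝓡 2) (𝓡 4) (f s) ((extChartAt (𝓡 2) x₀).symm y) (ξ a))))) T s := by
      refine h1.hasFDerivWithinAt.congr_fderiv ?_
      have key : ∀ (A : Euc 4 →L[ℝ] Euc 4) (V : Euc 4),
          A.comp (ContinuousLinearMap.toSpanSingleton ℝ V)
            = ContinuousLinearMap.toSpanSingleton ℝ (A V) :=
        fun A V => A.comp_toSpanSingleton V
      exact key _ _
    have h3 := h2.hasDerivWithinAt
    rw [ContinuousLinearMap.toSpanSingleton_apply, one_smul] at h3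
    refine h3.congr_deriv ?_
    rw [map_sum]
    refine Finset.sum_congr rfl fun a _ => ?_
    have h4 := h.mfderiv_frame hf hs hy (coframeAt x₀ ((extChartAt (𝓡 2) x₀).symm y) (ξ a))
    rw [frameAt_coframeAt (h.mem_source hy)] at h4
    rw [h4]
    exact (chartEnd_apply (𝓗.cplx a) hm _).symm

end IsFlowChart

end Flow

/-! ### Return to the base point: evolution of the induced metric. -/

section Flow

variable {S M : Type*} [TopologicalSpace S] [ChartedSpace (Euc 2) S] [IsManifold (𝓡 2) ∞ S]
  [TopologicalSpace M] [ChartedSpace (Euc 4) M] [IsManifold (𝓡 4) ∞ M]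
  {𝓗 : HyperKahler M} {ρ : AreaForm S} {τ : Set ℝ} {f : ℝ → S → M} {t₀ : ℝ} {x₀ : S}

lemma chartForm_self {n : ℕ} {N : Type*} [TopologicalSpace N] [ChartedSpace (Euc n) N]
    [IsManifold (𝓡 n) ∞ N] (b : ∀ x : N, TangentSpace (𝓡 n) x →L[ℝ] TangentSpace (𝓡 n) x →L[ℝ] ℝ)
    (q : N) : chartForm b q (extChartAt (𝓡 n) q q) = b q := by
  refine ContinuousLinearMap.ext fun v => ContinuousLinearMap.ext fun w => ?_
  rw [chartForm_apply b (mem_extChartAt_source q), frameAt_self, frameAt_self]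
  rfl

lemma chartEnd_self {n : ℕ} {N : Type*} [TopologicalSpace N] [ChartedSpace (Euc n) N]
    [IsManifold (𝓡 n) ∞ N] (A : ∀ x : N, TangentSpace (𝓡 n) x →L[ℝ] TangentSpace (𝓡 n) x)
    (q : N) (v : Euc n) : chartEnd A q (extChartAt (𝓡 n) q q) v = A q v := by
  rw [chartEnd_apply A (mem_extChartAt_source q), frameAt_self, coframeAt_self]

namespace IsFlowChart

variable {T : Set ℝ} {U : Set (Euc 2)} {s : ℝ} {y : Euc 2}

lemma coordFamily_base : coordFamily f x₀ (f t₀ x₀) (t₀, extChartAt (𝓡 2) x₀ x₀)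
    = extChartAt (𝓡 4) (f t₀ x₀) (f t₀ x₀) := by
  rw [coordFamily, extChartAt_to_inv]

lemma inducedMetric_base (h : IsFlowChart τ f t₀ x₀ T U) (hf : IsHFlow 𝓗 ρ τ f) (hs : s ∈ T) :
    inducedMetric 𝓗 (f s) x₀ = coordMetric (chartForm 𝓗.metric.inner (f t₀ x₀))
      (fun y => coordFamily f x₀ (f t₀ x₀) (s, y)) (extChartAt (𝓡 2) x₀ x₀) := by
  refine ContinuousLinearMap.ext fun (v : Euc 2) => ContinuousLinearMap.ext fun (w : Euc 2) => ?_
  have h1 := h.inducedMetric_frame hf hs h.mem_space v w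
  rw [extChartAt_to_inv, frameAt_self, frameAt_self] at h1
  exact h1

lemma chartForm_inducedMetric (h : IsFlowChart τ f t₀ x₀ T U) (hf : IsHFlow 𝓗 ρ τ f)
    (hs : s ∈ T) :
    chartForm (inducedMetric 𝓗 (f s)) x₀ =ᶠ[nhds (extChartAt (𝓡 2) x₀ x₀)]
      coordMetric (chartForm 𝓗.metric.inner (f t₀ x₀))
        (fun y => coordFamily f x₀ (f t₀ x₀) (s, y)) := by
  filter_upwards [h.isOpen.mem_nhds h.mem_space] with y hy
  ext v w
  exact h.inducedMetric_frame hf hs hy v w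

lemma mfderiv_base (h : IsFlowChart τ f t₀ x₀ T U) (hf : IsHFlow 𝓗 ρ τ f) (v : Euc 2) :
    mfderiv (𝓡 2) (𝓡 4) (f t₀) x₀ v
      = fderiv ℝ (fun y => coordFamily f x₀ (f t₀ x₀) (t₀, y)) (extChartAt (𝓡 2) x₀ x₀) v := by
  have h1 := h.mfderiv_frame hf h.mem_time h.mem_space v
  rw [extChartAt_to_inv, frameAt_self, frameAt_self] at h1
  exact h1

lemma covDerivAlong_base (h : IsFlowChart τ f t₀ x₀ T U) (hf : IsHFlow 𝓗 ρ τ f) (v w : Euc 2) :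
    covDerivAlong 𝓗 (f t₀) x₀ v w = coordCovDeriv (christoffel 𝓗.metric.inner (f t₀ x₀))
      (fun y => coordFamily f x₀ (f t₀ x₀) (t₀, y)) (extChartAt (𝓡 2) x₀ x₀) v w := by
  rw [coordCovDeriv, ← h.mfderiv_base hf, ← h.mfderiv_base hf]
  rfl

lemma metric_base : chartForm 𝓗.metric.inner (f t₀ x₀)
      (coordFamily f x₀ (f t₀ x₀) (t₀, extChartAt (𝓡 2) x₀ x₀)) = 𝓗.metric.inner (f t₀ x₀) := by
  rw [coordFamily_base, chartForm_self]

lemma secondFF_base (h : IsFlowChart τ f t₀ x₀ T U) (hf : IsHFlow 𝓗 ρ τ f) (v w : Euc 2) :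
    secondFF 𝓗 (f t₀) x₀ v w = coordSecondFF (chartForm 𝓗.metric.inner (f t₀ x₀))
      (christoffel 𝓗.metric.inner (f t₀ x₀))
      (fun y => coordFamily f x₀ (f t₀ x₀) (t₀, y)) (extChartAt (𝓡 2) x₀ x₀) v w := by
  rw [coordSecondFF, ← h.covDerivAlong_base hf, ← h.inducedMetric_base hf h.mem_time]
  simp only [← h.mfderiv_base hf, metric_base]
  rfl

lemma meanCurv_base (h : IsFlowChart τ f t₀ x₀ T U) (hf : IsHFlow 𝓗 ρ τ f) :
    meanCurv 𝓗 (f t₀) x₀ = coordMeanCurv (chartForm 𝓗.metric.inner (f t₀ x₀))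
      (christoffel 𝓗.metric.inner (f t₀ x₀))
      (fun y => coordFamily f x₀ (f t₀ x₀) (t₀, y)) (extChartAt (𝓡 2) x₀ x₀) := by
  rw [coordMeanCurv, ← h.inducedMetric_base hf h.mem_time]
  simp only [← h.secondFF_base hf]
  rfl

lemma lam_sq_base (h : IsFlowChart τ f t₀ x₀ T U) (hf : IsHFlow 𝓗 ρ τ f) (hs : s ∈ T) :
    lam 𝓗 ρ (f s) x₀ ^ 2
      = coordLamSq (chartForm 𝓗.metric.inner (f t₀ x₀)) (coordArea ρ x₀)
        (fun y => coordFamily f x₀ (f t₀ x₀) (s, y)) (extChartAt (𝓡 2) x₀ x₀) := by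
  rw [← h.lam_sq hf hs h.mem_space, extChartAt_to_inv]

lemma christoffel_low (𝓗 : HyperKahler M) (q : M) (v w z : Euc 4) :
    chartForm 𝓗.metric.inner q (extChartAt (𝓡 4) q q) (christoffel 𝓗.metric.inner q v w) z
      = 1 / 2 * (fderiv ℝ (chartForm 𝓗.metric.inner q) (extChartAt (𝓡 4) q q) v w z
        + fderiv ℝ (chartForm 𝓗.metric.inner q) (extChartAt (𝓡 4) q q) w v z
        - fderiv ℝ (chartForm 𝓗.metric.inner q) (extChartAt (𝓡 4) q q) z v w) := by
  rw [chartForm_self]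
  exact inner_metricTrace_low (B := 𝓗.metric.inner q) (𝓗.metric.pos q)
    (fderiv ℝ (chartForm 𝓗.metric.inner q) (extChartAt (𝓡 4) q q)) v w z

lemma christoffel_induced_low (h : IsFlowChart τ f t₀ x₀ T U) (hf : IsHFlow 𝓗 ρ τ f)
    (v w z : Euc 2) :
    let g := coordMetric (chartForm 𝓗.metric.inner (f t₀ x₀))
      (fun y => coordFamily f x₀ (f t₀ x₀) (t₀, y))
    g (extChartAt (𝓡 2) x₀ x₀) (christoffel (inducedMetric 𝓗 (f t₀)) x₀ v w) z
      = 1 / 2 * (fderiv ℝ g (extChartAt (𝓡 2) x₀ x₀) v w z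
        + fderiv ℝ g (extChartAt (𝓡 2) x₀ x₀) w v z
        - fderiv ℝ g (extChartAt (𝓡 2) x₀ x₀) z v w) := by
  intro g
  have h1 := inner_metricTrace_low (B := inducedMetric 𝓗 (f t₀) x₀)
    (inducedMetric_pos 𝓗 (hf.immersion t₀ (h.subset h.mem_time) x₀))
    (fderiv ℝ (chartForm (inducedMetric 𝓗 (f t₀)) x₀) (extChartAt (𝓡 2) x₀ x₀)) v w z
  rw [(h.chartForm_inducedMetric hf h.mem_time).fderiv_eq] at h1
  rw [← h1]
  have h2 : christoffel (inducedMetric 𝓗 (f t₀)) x₀ v w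
      = metricTrace (inducedMetric 𝓗 (f t₀) x₀) fun a b =>
        (1 / 2 * (fderiv ℝ (chartForm (inducedMetric 𝓗 (f t₀)) x₀) (extChartAt (𝓡 2) x₀ x₀) v w a
        + fderiv ℝ (chartForm (inducedMetric 𝓗 (f t₀)) x₀) (extChartAt (𝓡 2) x₀ x₀) w v a
        - fderiv ℝ (chartForm (inducedMetric 𝓗 (f t₀)) x₀) (extChartAt (𝓡 2) x₀ x₀) a v w)) • b :=
    rfl
  rw [h2, (h.chartForm_inducedMetric hf h.mem_time).fderiv_eq, h.inducedMetric_base hf h.mem_time]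

lemma hess_base (h : IsFlowChart τ f t₀ x₀ T U) (hf : IsHFlow 𝓗 ρ τ f) (v w : Euc 2) :
    let u := coordLamSq (chartForm 𝓗.metric.inner (f t₀ x₀)) (coordArea ρ x₀)
        (fun y => coordFamily f x₀ (f t₀ x₀) (t₀, y))
    hess (inducedMetric 𝓗 (f t₀)) (fun y => lam 𝓗 ρ (f t₀) y ^ 2) x₀ v w
      = fderiv ℝ (fderiv ℝ u) (extChartAt (𝓡 2) x₀ x₀) v w
        - fderiv ℝ u (extChartAt (𝓡 2) x₀ x₀)
          (christoffel (inducedMetric 𝓗 (f t₀)) x₀ v w) := by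
  intro u
  have h1 : (fun y => lam 𝓗 ρ (f t₀) y ^ 2) ∘ (extChartAt (𝓡 2) x₀).symm
      =ᶠ[nhds (extChartAt (𝓡 2) x₀ x₀)] u := by
    filter_upwards [h.isOpen.mem_nhds h.mem_space] with y hy using h.lam_sq hf h.mem_time hy
  simp only [hess]
  rw [h1.fderiv.fderiv_eq, h1.fderiv_eq]

/-- Evolution of the induced metric, without a normal frame. -/
lemma hasDerivWithinAt_inducedMetric (h : IsFlowChart τ f t₀ x₀ T U) (hf : IsHFlow 𝓗 ρ τ f)
    (v w : Euc 2) :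
    HasDerivWithinAt (fun s => inducedMetric 𝓗 (f s) x₀ v w)
      (hess (inducedMetric 𝓗 (f t₀)) (fun y => lam 𝓗 ρ (f t₀) y ^ 2) x₀ v w
        - 2 * lam 𝓗 ρ (f t₀) x₀ ^ 2 *
          𝓗.metric.inner (f t₀ x₀) (meanCurv 𝓗 (f t₀) x₀) (secondFF 𝓗 (f t₀) x₀ v w)) τ t₀ := by
  have hI := h.isCoordImmersion hf h.mem_time
  have hu : UniqueDiffOn ℝ T := uniqueDiffOn_convex h.convex h.interior_nonempty
  -- The flow equation gives the velocity through vectors `η` depending on `y` with no stated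
  -- regularity. As a time derivative of the smooth family, `V` is differentiable in `y`, and `hsw`
  -- also gives `∂_t ∂_k F = ∂_k V`.
  set V : Euc 2 → Euc 4 := fun y =>
    derivWithin (fun s => coordFamily f x₀ (f t₀ x₀) (s, y)) T t₀ with hVdef
  have hV : ∀ y ∈ U, HasDerivWithinAt (fun s => coordFamily f x₀ (f t₀ x₀) (s, y)) (V y) T t₀ := by
    intro y hy
    obtain ⟨η, _, hd⟩ := h.exists_velocity hf h.mem_time hy
    exact hd.differentiableWithinAt.hasDerivWithinAt
  have hsw := hasDerivWithinAt_fderiv_slice h.convex h.interior_nonempty h.isOpen h.smooth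
    h.mem_time hV h.mem_space
  have hvar := hI.metric_variation h.mem_space (Γ := christoffel 𝓗.metric.inner (f t₀ x₀))
    (by
      rw [coordFamily_base]
      exact christoffel_low 𝓗 (f t₀ x₀))
    (by
      intro a v w
      rw [coordFamily_base, chartEnd_self, chartEnd_self]
      exact 𝓗.parallel a (f t₀ x₀) v w)
    (h.christoffel_induced_low hf) (hsw 0).1
    (by
      intro y hy
      obtain ⟨η, hη, hd⟩ := h.exists_velocity hf h.mem_time hy
      exact ⟨η, hη, hd.derivWithin (hu t₀ h.mem_time)⟩) v w
  rw [h.hess_base hf, h.lam_sq_base hf h.mem_time, h.meanCurv_base hf, h.secondFF_base hf]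
  rw [metric_base] at hvar
  refine HasDerivWithinAt.congr_deriv ?_ hvar
  -- `T` is a neighbourhood of `t₀` in `τ`, so the derivative within `T` is the derivative within
  -- `τ`.
  refine HasDerivWithinAt.mono_of_mem_nhdsWithin (s := τ) ?_ h.mem_nhdsWithin
  have hG : HasFDerivAt (chartForm 𝓗.metric.inner (f t₀ x₀))
      (fderiv ℝ (chartForm 𝓗.metric.inner (f t₀ x₀))
        (coordFamily f x₀ (f t₀ x₀) (t₀, extChartAt (𝓡 2) x₀ x₀)))
      (coordFamily f x₀ (f t₀ x₀) (t₀, extChartAt (𝓡 2) x₀ x₀)) :=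
    ((hI.metric_smooth.differentiableOn (by simp)).differentiableAt
      (hI.isOpen_target.mem_nhds (hI.mapsTo h.mem_space))).hasFDerivAt
  have hGt := hG.comp_hasDerivWithinAt t₀ (hV _ h.mem_space)
  have hd := (hGt.clm_apply (hsw v).2).clm_apply (hsw w).2
  have hd' := hd.congr (f₁ := fun s => inducedMetric 𝓗 (f s) x₀ v w)
    (fun s hs => by rw [h.inducedMetric_base hf hs]; rfl)
    (by rw [h.inducedMetric_base hf h.mem_time]; rfl)
  refine hd'.congr_deriv ?_
  simp only [_root_.add_apply, Function.comp_apply, metric_base]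

end IsFlowChart

end Flow

/-! ### Evolution of the determinant, the area form and `λ²`. -/

lemma gramDet_eq {B : Euc 2 →L[ℝ] Euc 2 →L[ℝ] ℝ} (hB : ∀ v w, B v w = B w v) :
    gramDet B = B (basisVec 2 0) (basisVec 2 0) * B (basisVec 2 1) (basisVec 2 1)
      - B (basisVec 2 0) (basisVec 2 1) * B (basisVec 2 1) (basisVec 2 0) := by
  rw [gramDet, hB (basisVec 2 1) (basisVec 2 0), pow_two]

/-- Jacobi's formula for the variation `T - c R` of a symmetric form on `ℝ²`. -/
lemma metricTrace_mul_gramDet {B : Euc 2 →L[ℝ] Euc 2 →L[ℝ] ℝ} (hB : ∀ v w, B v w = B w v)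
    (hP : gramDet B ≠ 0) (T R : Euc 2 → Euc 2 → ℝ) (c : ℝ) :
    (T (basisVec 2 0) (basisVec 2 0) - c * R (basisVec 2 0) (basisVec 2 0))
        * B (basisVec 2 1) (basisVec 2 1)
      + B (basisVec 2 0) (basisVec 2 0)
        * (T (basisVec 2 1) (basisVec 2 1) - c * R (basisVec 2 1) (basisVec 2 1))
      - ((T (basisVec 2 0) (basisVec 2 1) - c * R (basisVec 2 0) (basisVec 2 1))
        * B (basisVec 2 1) (basisVec 2 0)
      + B (basisVec 2 0) (basisVec 2 1)
        * (T (basisVec 2 1) (basisVec 2 0) - c * R (basisVec 2 1) (basisVec 2 0)))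
      = (metricTrace B T - c * metricTrace B R) * gramDet B := by
  rw [metricTrace_two hB, metricTrace_two hB, hB (basisVec 2 1) (basisVec 2 0)]
  simp only [smul_eq_mul]
  field_simp
  ring

lemma fderiv_const_smul_fun {E E' : Type*} [NormedAddCommGroup E] [NormedSpace ℝ E]
    [NormedAddCommGroup E'] [NormedSpace ℝ E'] (c : ℝ) (φ : E → E') :
    fderiv ℝ (fun x => c • φ x) = fun x => c • fderiv ℝ φ x :=
  fderiv_const_smul_field c

/-- An orthonormal normal frame computes the inner product of normal vectors. -/
lemma sum_inner_normalFrame {G : Euc 4 →L[ℝ] Euc 4 →L[ℝ] ℝ} (hsymm : ∀ v w, G v w = G w v)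
    (hpos : ∀ v, v ≠ 0 → 0 < G v v) {D : Euc 2 →L[ℝ] Euc 4} (hD : Function.Injective D)
    {e : Fin 2 → Euc 4} (he : ∀ α β, G (e α) (e β) = if α = β then 1 else 0)
    (heD : ∀ α v, G (e α) (D v) = 0) {A : Euc 4} (hA : ∀ v, G (D v) A = 0) (B : Euc 4) :
    ∑ α, G (e α) B * G (e α) A = G B A := by
  have hli : LinearIndependent ℝ ![e 0, e 1, D (basisVec 2 0), D (basisVec 2 1)] := by
    rw [Fintype.linearIndependent_iff]
    intro c hc
    simp only [Fin.sum_univ_four, Matrix.cons_val] at hc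
    have h0 := congrArg (G (e 0)) hc
    have h1 := congrArg (G (e 1)) hc
    simp only [map_add, map_smul, map_zero, he, heD, smul_eq_mul] at h0 h1
    simp at h0 h1
    rw [h0, h1] at hc
    have h2 : D (c 2 • basisVec 2 0 + c 3 • basisVec 2 1) = D 0 := by
      simpa using hc
    have h3 := hD h2
    have h20 := congrArg (fun v : Euc 2 => v 0) h3
    have h21 := congrArg (fun v : Euc 2 => v 1) h3
    simp [basisVec] at h20 h21
    intro i
    fin_cases i
    · exact h0
    · exact h1
    · exact h20
    · exact h21
  -- The normal frame and the tangent vectors form a basis; `A` minus its expansion in the frame is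
  -- orthogonal to all of it.
  have hz := eq_zero_of_orthogonal hpos hli (z := A - ∑ α, G (e α) A • e α) (by
    intro i
    fin_cases i
    · simp [Fin.sum_univ_two, he]
    · simp [Fin.sum_univ_two, he]
    · change G (D (basisVec 2 0)) _ = 0
      rw [map_sub, hA]
      simp [Fin.sum_univ_two, hsymm (D _) (e _), heD]
    · change G (D (basisVec 2 1)) _ = 0
      rw [map_sub, hA]
      simp [Fin.sum_univ_two, hsymm (D _) (e _), heD])
  have := congrArg (G B) hz
  simp only [Fin.sum_univ_two, map_sub, map_add, map_smul, smul_eq_mul, map_zero] at this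
  rw [Fin.sum_univ_two, hsymm (e 0) B, hsymm (e 1) B]
  linarith

section Flow

variable {S M : Type*} [TopologicalSpace S] [ChartedSpace (Euc 2) S] [IsManifold (𝓡 2) ∞ S]
  [TopologicalSpace M] [ChartedSpace (Euc 4) M] [IsManifold (𝓡 4) ∞ M]
  {𝓗 : HyperKahler M} {ρ : AreaForm S} {τ : Set ℝ} {f : ℝ → S → M} {t₀ : ℝ} {x₀ : S}

/-- Constant multiples pass through `fderiv` unconditionally, so no regularity of `u` is required.
-/
lemma hess_div_two (g : ∀ x : S, TangentSpace (𝓡 2) x →L[ℝ] TangentSpace (𝓡 2) x →L[ℝ] ℝ)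
    (u : S → ℝ) (x : S) (v w : Euc 2) :
    hess g (fun y => u y / 2) x v w = 1 / 2 * hess g u x v w := by
  have h1 : (fun y => u y / 2) ∘ (extChartAt (𝓡 2) x).symm
      = fun y => (1 / 2 : ℝ) • (u ∘ (extChartAt (𝓡 2) x).symm) y := by
    funext y
    simp only [Function.comp_apply, smul_eq_mul]
    ring
  simp only [hess]
  have h2 : fderiv ℝ (fun y => (1 / 2 : ℝ) • (u ∘ (extChartAt (𝓡 2) x).symm) y)
      = fun y => (1 / 2 : ℝ) • fderiv ℝ (u ∘ (extChartAt (𝓡 2) x).symm) y :=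
    fderiv_const_smul_fun _ _
  have h3 := congrFun (fderiv_const_smul_fun (1 / 2 : ℝ)
    (fderiv ℝ (u ∘ (extChartAt (𝓡 2) x).symm))) (extChartAt (𝓡 2) x x)
  rw [h1, h2, h3]
  simp only [_root_.smul_apply, smul_eq_mul]
  ring

lemma laplacian_div_two (g : ∀ x : S, TangentSpace (𝓡 2) x →L[ℝ] TangentSpace (𝓡 2) x →L[ℝ] ℝ)
    (u : S → ℝ) (x : S) :
    laplacian g (fun y => u y / 2) x = 1 / 2 * laplacian g u x := by
  have h1 : hess g (fun y => u y / 2) x = fun v w => 1 / 2 * hess g u x v w := by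
    funext v w
    exact hess_div_two g u x v w
  simp only [laplacian, h1, metricTrace, smul_eq_mul, Finset.mul_sum]
  exact Finset.sum_congr rfl fun i _ => Finset.sum_congr rfl fun j _ => by ring

/-- Linearity of `⟨H, ·⟩` carries it through the trace defining `H`; this turns the trace of `⟨H,
A⟩` into `|H|²`. -/
lemma meanCurvSq_eq (𝓗 : HyperKahler M) (g : S → M) (x : S) :
    meanCurvSq 𝓗 g x = metricTrace (inducedMetric 𝓗 g x) fun v w =>
      𝓗.metric.inner (g x) (meanCurv 𝓗 g x) (secondFF 𝓗 g x v w) :=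
  map_metricTrace (𝓗.metric.inner (g x) (meanCurv 𝓗 g x)).toLinearMap (inducedMetric 𝓗 g x)
    fun v w => secondFF 𝓗 g x v w

namespace IsFlowChart

variable {T : Set ℝ} {U : Set (Euc 2)} {s : ℝ} {y : Euc 2}

lemma secondFF_normal (h : IsFlowChart τ f t₀ x₀ T U) (hf : IsHFlow 𝓗 ρ τ f) (v w z : Euc 2) :
    𝓗.metric.inner (f t₀ x₀) (mfderiv (𝓡 2) (𝓡 4) (f t₀) x₀ z) (secondFF 𝓗 (f t₀) x₀ v w) = 0 := by
  have hI := h.isCoordImmersion hf h.mem_time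
  have h1 := hI.coordSecondFF_normal h.mem_space (Γ := christoffel 𝓗.metric.inner (f t₀ x₀))
    (by
      rw [coordFamily_base]
      exact christoffel_low 𝓗 (f t₀ x₀)) v w z
  rw [metric_base, ← h.secondFF_base hf, ← h.mfderiv_base hf] at h1
  exact h1

end IsFlowChart

/-- Evolution of the metric in terms of a normal frame. -/
lemma IsHFlow.hasDerivWithinAt_metric (hf : IsHFlow 𝓗 ρ τ f) (hτ : τ.OrdConnected)
    (hτ' : τ.Nontrivial) (ht : t₀ ∈ τ) (v w : Euc 2)
    (e : Fin 2 → TangentSpace (𝓡 4) (f t₀ x₀)) (he : IsNormalFrame 𝓗 (f t₀) x₀ e) :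
    HasDerivWithinAt (fun s => inducedMetric 𝓗 (f s) x₀ v w)
      (hess (inducedMetric 𝓗 (f t₀)) (fun y => lam 𝓗 ρ (f t₀) y ^ 2) x₀ v w
        - 2 * lam 𝓗 ρ (f t₀) x₀ ^ 2 *
          ∑ α, 𝓗.metric.inner (f t₀ x₀) (e α) (meanCurv 𝓗 (f t₀) x₀) *
            𝓗.metric.inner (f t₀ x₀) (e α) (secondFF 𝓗 (f t₀) x₀ v w)) τ t₀ := by
  obtain ⟨T, U, h⟩ := exists_isFlowChart hτ hτ' hf ht x₀
  have h1 := sum_inner_normalFrame (G := 𝓗.metric.inner (f t₀ x₀)) (𝓗.metric.symm _)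
    (𝓗.metric.pos _) (D := mfderiv (𝓡 2) (𝓡 4) (f t₀) x₀) (hf.immersion t₀ ht x₀) he.1 he.2
    (A := secondFF 𝓗 (f t₀) x₀ v w) (h.secondFF_normal hf v w) (meanCurv 𝓗 (f t₀) x₀)
  exact (h.hasDerivWithinAt_inducedMetric hf v w).congr_deriv
    (congrArg (fun a : ℝ => hess (inducedMetric 𝓗 (f t₀)) (fun y => lam 𝓗 ρ (f t₀) y ^ 2) x₀ v w
        - 2 * lam 𝓗 ρ (f t₀) x₀ ^ 2 * a) h1.symm)

/-- Jacobi's formula applied to the metric variation. The area form and `λ²` are this determinant up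
to a square root and time-independent factors, so both evolution laws follow from it. -/
lemma IsHFlow.hasDerivWithinAt_gramDet (hf : IsHFlow 𝓗 ρ τ f) (hτ : τ.OrdConnected)
    (hτ' : τ.Nontrivial) (ht : t₀ ∈ τ) :
    HasDerivWithinAt (fun s => gramDet (inducedMetric 𝓗 (f s) x₀))
      ((laplacian (inducedMetric 𝓗 (f t₀)) (fun y => lam 𝓗 ρ (f t₀) y ^ 2) x₀
        - 2 * lam 𝓗 ρ (f t₀) x₀ ^ 2 * meanCurvSq 𝓗 (f t₀) x₀)
        * gramDet (inducedMetric 𝓗 (f t₀) x₀)) τ t₀ := by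
  obtain ⟨T, U, h⟩ := exists_isFlowChart hτ hτ' hf ht x₀
  have hd := h.hasDerivWithinAt_inducedMetric hf
  have h1 := ((hd (basisVec 2 0) (basisVec 2 0)).mul (hd (basisVec 2 1) (basisVec 2 1))).sub
    ((hd (basisVec 2 0) (basisVec 2 1)).mul (hd (basisVec 2 1) (basisVec 2 0)))
  have hP := (gramDet_pos (B := inducedMetric 𝓗 (f t₀) x₀) (inducedMetric_symm 𝓗 _ _)
    (inducedMetric_pos 𝓗 (hf.immersion t₀ ht x₀))).ne'
  have hfun : (fun s => gramDet (inducedMetric 𝓗 (f s) x₀)) = fun s =>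
      inducedMetric 𝓗 (f s) x₀ (basisVec 2 0) (basisVec 2 0) *
        inducedMetric 𝓗 (f s) x₀ (basisVec 2 1) (basisVec 2 1)
      - inducedMetric 𝓗 (f s) x₀ (basisVec 2 0) (basisVec 2 1) *
        inducedMetric 𝓗 (f s) x₀ (basisVec 2 1) (basisVec 2 0) := by
    funext s
    exact gramDet_eq (inducedMetric_symm 𝓗 (f s) x₀)
  rw [hfun]
  refine h1.congr_deriv ?_
  rw [meanCurvSq_eq, laplacian]
  exact metricTrace_mul_gramDet (inducedMetric_symm 𝓗 (f t₀) x₀) hP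
    (hess (inducedMetric 𝓗 (f t₀)) (fun y => lam 𝓗 ρ (f t₀) y ^ 2) x₀)
    (fun v w => 𝓗.metric.inner (f t₀ x₀) (meanCurv 𝓗 (f t₀) x₀) (secondFF 𝓗 (f t₀) x₀ v w))
    (2 * lam 𝓗 ρ (f t₀) x₀ ^ 2)

lemma IsHFlow.gramDet_pos (hf : IsHFlow 𝓗 ρ τ f) (ht : t₀ ∈ τ) :
    0 < gramDet (inducedMetric 𝓗 (f t₀) x₀) :=
  HFlow.gramDet_pos (B := inducedMetric 𝓗 (f t₀) x₀) (inducedMetric_symm 𝓗 _ _)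
    (inducedMetric_pos 𝓗 (hf.immersion t₀ ht x₀))

/-- Evolution of the area form. -/
lemma IsHFlow.hasDerivWithinAt_area (hf : IsHFlow 𝓗 ρ τ f) (hτ : τ.OrdConnected)
    (hτ' : τ.Nontrivial) (ht : t₀ ∈ τ) (v w : Euc 2) :
    HasDerivWithinAt (fun s => inducedArea 𝓗 ρ (f s) x₀ v w)
      ((laplacian (inducedMetric 𝓗 (f t₀)) (fun y => lam 𝓗 ρ (f t₀) y ^ 2 / 2) x₀
        - lam 𝓗 ρ (f t₀) x₀ ^ 2 * meanCurvSq 𝓗 (f t₀) x₀)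
        * inducedArea 𝓗 ρ (f t₀) x₀ v w) τ t₀ := by
  have hP := hf.gramDet_pos ht (x₀ := x₀)
  have h1 := (hf.hasDerivWithinAt_gramDet hτ hτ' ht (x₀ := x₀)).sqrt hP.ne'
  have h2 := h1.const_mul (wedge v w *
    (SignType.sign (ρ.form x₀ (basisVec 2 0) (basisVec 2 1)) : ℝ))
  have hfun : ∀ s, inducedArea 𝓗 ρ (f s) x₀ v w = wedge v w *
      (SignType.sign (ρ.form x₀ (basisVec 2 0) (basisVec 2 1)) : ℝ)
        * Real.sqrt (gramDet (inducedMetric 𝓗 (f s) x₀)) := by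
    intro s
    rw [inducedArea_apply, mul_assoc]
    rfl
  simp only [hfun]
  refine h2.congr_deriv ?_
  rw [laplacian_div_two]
  have h3 := Real.sq_sqrt hP.le
  have h4 := (Real.sqrt_pos.2 hP).ne'
  generalize Real.sqrt (gramDet (inducedMetric 𝓗 (f t₀) x₀)) = σ at *
  rw [← h3]
  field_simp

/-- Evolution of `λ²`. -/
lemma IsHFlow.hasDerivWithinAt_lam_sq (hf : IsHFlow 𝓗 ρ τ f) (hτ : τ.OrdConnected)
    (hτ' : τ.Nontrivial) (ht : t₀ ∈ τ) :
    HasDerivWithinAt (fun s => lam 𝓗 ρ (f s) x₀ ^ 2)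
      (lam 𝓗 ρ (f t₀) x₀ ^ 2 *
          laplacian (inducedMetric 𝓗 (f t₀)) (fun y => lam 𝓗 ρ (f t₀) y ^ 2) x₀
        - 2 * (lam 𝓗 ρ (f t₀) x₀ ^ 2) ^ 2 * meanCurvSq 𝓗 (f t₀) x₀) τ t₀ := by
  have h1 := (hf.hasDerivWithinAt_gramDet hτ hτ' ht (x₀ := x₀)).div_const
    (ρ.form x₀ (basisVec 2 0) (basisVec 2 1) ^ 2)
  have h2 := h1.congr (fun s hs => lam_sq_eq 𝓗 ρ (hf.immersion s hs x₀))
    (lam_sq_eq 𝓗 ρ (hf.immersion t₀ ht x₀))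
  refine h2.congr_deriv ?_
  rw [mul_div_assoc, ← lam_sq_eq 𝓗 ρ (hf.immersion t₀ ht x₀)]
  ring

lemma lam_nonneg (𝓗 : HyperKahler M) (ρ : AreaForm S) (g : S → M) (x : S) : 0 ≤ lam 𝓗 ρ g x := by
  have h1 : lam 𝓗 ρ g x = (SignType.sign (ρ.form x (basisVec 2 0) (basisVec 2 1)) : ℝ) *
    Real.sqrt (gramDet (inducedMetric 𝓗 g x)) / ρ.form x (basisVec 2 0) (basisVec 2 1) := rfl
  rw [h1]
  rcases lt_or_gt_of_ne (ρ.basis_ne_zero x) with h | h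
  · rw [sign_neg h]
    simp only [SignType.coe_neg_one, neg_one_mul]
    exact div_nonneg_of_nonpos (neg_nonpos.2 (Real.sqrt_nonneg _)) h.le
  · rw [sign_pos h]
    simp only [SignType.coe_one, one_mul]
    positivity

end Flow

/-! ### The maximum principle. -/

/-- The second derivative test. -/
lemma fderiv_fderiv_nonpos_of_isLocalMax {E : Type*} [NormedAddCommGroup E] [NormedSpace ℝ E]
    {φ : E → ℝ} {y : E} (hφ : ContDiffAt ℝ 2 φ y) (hm : IsLocalMax φ y) (v : E) :
    fderiv ℝ (fderiv ℝ φ) y v v ≤ 0 := by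
  set γ : ℝ → E := fun s => y + s • v with hγ
  have hγ0 : γ 0 = y := by simp [hγ]
  have hγd : ∀ s, HasDerivAt γ v s := fun s =>
    (((hasDerivAt_id s).smul_const v).const_add y).congr_deriv (one_smul ℝ v)
  have hγc : Filter.Tendsto γ (nhds 0) (nhds y) := by
    have := (hγd 0).continuousAt.tendsto
    rwa [hγ0] at this
  have hd1 : ∀ᶠ x in nhds y, DifferentiableAt ℝ φ x := by
    filter_upwards [hφ.eventually (by simp)] with x hx using hx.differentiableAt (by simp)
  have hd2 : DifferentiableAt ℝ (fderiv ℝ φ) (γ 0) := by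
    rw [hγ0]
    exact (hφ.fderiv_right (m := 1) (by norm_num)).differentiableAt (by simp)
  have h1 : deriv (φ ∘ γ) =ᶠ[nhds 0] fun s => fderiv ℝ φ (γ s) v := by
    filter_upwards [hγc.eventually hd1] with s hs
    exact (hs.hasFDerivAt.comp_hasDerivAt s (hγd s)).deriv
  have h2 : deriv (deriv (φ ∘ γ)) 0 = fderiv ℝ (fderiv ℝ φ) y v v := by
    rw [h1.deriv_eq]
    have h3 := (hd2.hasFDerivAt.comp_hasDerivAt (0 : ℝ) (hγd 0)).clm_apply (hasDerivAt_const 0 v)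
    have h4 := h3.deriv
    simp only [Function.comp_apply, map_zero, add_zero, hγ0] at h4
    exact h4
  -- A positive second derivative along the line would make the maximum also a local minimum, so the
  -- restriction would be locally constant with zero second derivative.
  by_contra! hpos
  rw [← h2] at hpos
  have hmax : IsLocalMax (φ ∘ γ) 0 := by
    have h5 : ∀ᶠ s in nhds (0 : ℝ), φ (γ s) ≤ φ y := hγc.eventually hm
    rw [← hγ0] at h5
    exact h5
  have hcont : ContinuousAt (φ ∘ γ) 0 := by
    refine ContinuousAt.comp ?_ (hγd 0).continuousAt
    rw [hγ0]
    exact hφ.continuousAt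
  have hmin := isLocalMin_of_deriv_deriv_pos hpos hmax.deriv_eq_zero hcont
  have hconst : φ ∘ γ =ᶠ[nhds 0] fun _ => (φ ∘ γ) 0 := by
    filter_upwards [hmax, hmin] with s h6 h7 using le_antisymm h6 h7
  have := hconst.deriv.deriv_eq
  simp at this
  exact hpos.ne' this

/-- The trace of a nonpositive bilinear form is nonpositive. -/
lemma metricTrace_nonpos {B : Euc 2 →L[ℝ] Euc 2 →L[ℝ] ℝ} (hB : ∀ v w, B v w = B w v)
    (hpos : ∀ v, v ≠ 0 → 0 < B v v) (A : Euc 2 →L[ℝ] Euc 2 →L[ℝ] ℝ) (hA : ∀ v, A v v ≤ 0) :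
    metricTrace B (fun v w => A v w) ≤ 0 := by
  have hdet := gramDet_pos hB hpos
  have h00 : 0 < B (basisVec 2 0) (basisVec 2 0) :=
    hpos _ fun h => by simpa [basisVec] using congrArg (fun v : Euc 2 => v 0) h
  rw [metricTrace_two hB, smul_eq_mul]
  refine mul_nonpos_of_nonneg_of_nonpos (inv_nonneg.2 hdet.le) ?_
  simp only [smul_eq_mul]
  -- With `w = B₀₀e₁ - B₀₁e₀`, the unnormalised trace times `B₀₀` equals `A(w,w) + det B ·
  -- A(e₀,e₀)`.
  have h1 := hA (B (basisVec 2 0) (basisVec 2 0) • basisVec 2 1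
      - B (basisVec 2 0) (basisVec 2 1) • basisVec 2 0)
  have h2 := mul_nonpos_of_nonneg_of_nonpos hdet.le (hA (basisVec 2 0))
  rw [gramDet] at h2
  simp only [map_sub, map_smul, _root_.sub_apply, _root_.smul_apply, smul_eq_mul] at h1
  refine nonpos_of_mul_nonpos_right (a := B (basisVec 2 0) (basisVec 2 0)) ?_ h00
  linarith

section Flow

variable {S M : Type*} [TopologicalSpace S] [ChartedSpace (Euc 2) S] [IsManifold (𝓡 2) ∞ S]
  [TopologicalSpace M] [ChartedSpace (Euc 4) M] [IsManifold (𝓡 4) ∞ M]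
  {𝓗 : HyperKahler M} {ρ : AreaForm S} {τ : Set ℝ} {f : ℝ → S → M} {t₀ : ℝ} {x₀ : S}

lemma meanCurvSq_nonneg (𝓗 : HyperKahler M) (g : S → M) (x : S) : 0 ≤ meanCurvSq 𝓗 g x := by
  by_cases h : meanCurv 𝓗 g x = 0
  · rw [meanCurvSq, h, map_zero]
  · exact (𝓗.metric.pos _ _ h).le

namespace IsFlowChart

variable {T : Set ℝ} {U : Set (Euc 2)}

/-- At a maximum the differential vanishes, so the Christoffel term drops and the Hessian is the
ordinary second derivative, which is nonpositive. -/
lemma laplacian_nonpos (h : IsFlowChart τ f t₀ x₀ T U) (hf : IsHFlow 𝓗 ρ τ f)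
    (hm : ∀ y, lam 𝓗 ρ (f t₀) y ^ 2 ≤ lam 𝓗 ρ (f t₀) x₀ ^ 2) :
    laplacian (inducedMetric 𝓗 (f t₀)) (fun y => lam 𝓗 ρ (f t₀) y ^ 2) x₀ ≤ 0 := by
  have hI := h.isCoordImmersion hf h.mem_time
  set u := coordLamSq (chartForm 𝓗.metric.inner (f t₀ x₀)) (coordArea ρ x₀)
        (fun y => coordFamily f x₀ (f t₀ x₀) (t₀, y)) with hu
  have hmax : IsLocalMax u (extChartAt (𝓡 2) x₀ x₀) := by
    filter_upwards [h.isOpen.mem_nhds h.mem_space] with y hy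
    rw [hu, ← h.lam_sq hf h.mem_time hy, ← h.lam_sq_base hf h.mem_time]
    exact hm _
  have hcd : ContDiffAt ℝ 2 u (extChartAt (𝓡 2) x₀ x₀) :=
    (hI.contDiffAt hI.coordLamSq_smooth h.mem_space).of_le ENat.LEInfty.out
  have h1 : hess (inducedMetric 𝓗 (f t₀)) (fun y => lam 𝓗 ρ (f t₀) y ^ 2) x₀
      = fun v w => fderiv ℝ (fderiv ℝ u) (extChartAt (𝓡 2) x₀ x₀) v w := by
    funext v w
    rw [h.hess_base hf, ← hu, hmax.fderiv_eq_zero, _root_.zero_apply, sub_zero]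
  rw [laplacian, h1]
  exact metricTrace_nonpos (B := inducedMetric 𝓗 (f t₀) x₀) (inducedMetric_symm 𝓗 _ _)
    (inducedMetric_pos 𝓗 (hf.immersion t₀ (h.subset h.mem_time) x₀)) _
    (fderiv_fderiv_nonpos_of_isLocalMax hcd hmax)

lemma continuousOn_coordLamSq (h : IsFlowChart τ f t₀ x₀ T U) (hf : IsHFlow 𝓗 ρ τ f) :
    ContinuousOn (fun z : ℝ × Euc 2 => coordLamSq (chartForm 𝓗.metric.inner (f t₀ x₀))
      (coordArea ρ x₀) (fun y => coordFamily f x₀ (f t₀ x₀) (z.1, y)) z.2) (T ×ˢ U) := by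
  have hI := h.isCoordImmersion hf h.mem_time
  have hG : ContinuousOn (fun z : ℝ × Euc 2 => chartForm 𝓗.metric.inner (f t₀ x₀)
      (coordFamily f x₀ (f t₀ x₀) (z.1, z.2))) (T ×ˢ U) :=
    hI.metric_smooth.continuousOn.comp h.smooth.continuousOn
      fun z hz => (h.isCoordImmersion hf hz.1).mapsTo hz.2
  have hD := continuousOn_fderiv_slice (uniqueDiffOn_convex h.convex h.interior_nonempty)
    h.isOpen h.smooth
  have hDc : ∀ v : Euc 2, ContinuousOn (fun z : ℝ × Euc 2 =>
      fderiv ℝ (fun y => coordFamily f x₀ (f t₀ x₀) (z.1, y)) z.2 v) (T ×ˢ U) := fun v =>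
    hD.clm_apply continuousOn_const
  have hr : ContinuousOn (fun z : ℝ × Euc 2 => coordArea ρ x₀ z.2) (T ×ˢ U) :=
    hI.area_smooth.continuousOn.comp continuousOn_snd fun z hz => hz.2
  have hg : ∀ v w : Euc 2, ContinuousOn (fun z : ℝ × Euc 2 =>
      coordMetric (chartForm 𝓗.metric.inner (f t₀ x₀))
        (fun y => coordFamily f x₀ (f t₀ x₀) (z.1, y)) z.2 v w) (T ×ˢ U) := fun v w =>
    (hG.clm_apply (hDc v)).clm_apply (hDc w)
  exact (((hg _ _).mul (hg _ _)).sub ((hg _ _).pow 2)).div (hr.pow 2)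
    fun z hz => pow_ne_zero 2 (hI.area_ne_zero _ hz.2)

end IsFlowChart

lemma IsHFlow.continuousOn_lam_sq (hf : IsHFlow 𝓗 ρ τ f) (hτ : τ.OrdConnected)
    (hτ' : τ.Nontrivial) :
    ContinuousOn (fun z : ℝ × S => lam 𝓗 ρ (f z.1) z.2 ^ 2) (τ ×ˢ univ) := by
  rintro ⟨t, x⟩ ⟨ht, -⟩
  obtain ⟨T, U, h⟩ := exists_isFlowChart hτ hτ' hf ht x
  set O : Set S := (extChartAt (𝓡 2) x).source ∩ extChartAt (𝓡 2) x ⁻¹' U with hO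
  have hOn : O ∈ nhds x := Filter.inter_mem (extChartAt_source_mem_nhds x)
    ((continuousAt_extChartAt x).preimage_mem_nhds (h.isOpen.mem_nhds h.mem_space))
  have hTO : T ×ˢ O ∈ nhdsWithin (t, x) (τ ×ˢ univ) := by
    rw [nhdsWithin_prod_eq, nhdsWithin_univ]
    exact Filter.prod_mem_prod h.mem_nhdsWithin hOn
  have hc : ContinuousOn (fun z : ℝ × S => (z.1, extChartAt (𝓡 2) x z.2)) (T ×ˢ O) :=
    continuousOn_fst.prodMk ((continuousOn_extChartAt x).comp continuousOn_snd
      fun z hz => hz.2.1)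
  have h1 := (h.continuousOn_coordLamSq hf).comp hc fun z hz => ⟨hz.1, hz.2.2⟩
  have h2 : ContinuousOn (fun z : ℝ × S => lam 𝓗 ρ (f z.1) z.2 ^ 2) (T ×ˢ O) := by
    refine h1.congr fun z hz => ?_
    have h3 := h.lam_sq hf hz.1 hz.2.2
    rw [(extChartAt (𝓡 2) x).left_inv hz.2.1] at h3
    exact h3
  exact (h2 (t, x) ⟨h.mem_time, mem_of_mem_nhds hOn⟩).mono_of_mem_nhdsWithin hTO

/-- The maximum principle for `λ`. -/
lemma IsHFlow.lam_le_iSup [CompactSpace S] (hf : IsHFlow 𝓗 ρ τ f) (hτ : τ.OrdConnected)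
    (hτ' : τ.Nontrivial) (h0 : IsLeast τ 0) {t : ℝ} (ht : t ∈ τ) (x : S) :
    lam 𝓗 ρ (f t) x ≤ ⨆ y : S, lam 𝓗 ρ (f 0) y := by
  have ht0 : 0 ≤ t := h0.2 ht
  have hsub : Icc 0 t ⊆ τ := hτ.out h0.1 ht
  have hc : ContinuousOn (fun z : ℝ × S => lam 𝓗 ρ (f z.1) z.2 ^ 2) (Icc 0 t ×ˢ univ) :=
    (hf.continuousOn_lam_sq hτ hτ').mono (prod_mono_left hsub)
  -- A real supremum of an unbounded set is `0` by convention, so boundedness is needed for `⨆` to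
  -- be an upper bound.
  have hbdd : BddAbove (range fun y : S => lam 𝓗 ρ (f 0) y) := by
    obtain ⟨C, hC⟩ := ((isCompact_Icc.prod isCompact_univ).image_of_continuousOn hc).bddAbove
    refine ⟨Real.sqrt C, ?_⟩
    rintro _ ⟨y, rfl⟩
    exact Real.le_sqrt_of_sq_le (hC ⟨(0, y), ⟨⟨le_rfl, ht0⟩, trivial⟩, rfl⟩)
  set m := ⨆ y : S, lam 𝓗 ρ (f 0) y with hm
  have hm' : ∀ y, lam 𝓗 ρ (f 0) y ≤ m := le_ciSup hbdd
  have hm0 : 0 ≤ m := (lam_nonneg 𝓗 ρ (f 0) x).trans (hm' x)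
  -- Subtracting `ε s` makes the evolution inequality strict at a spatial maximum, which forces the
  -- maximum over `[0,t] × S` to be at time `0`.
  have key : ∀ ε > 0, lam 𝓗 ρ (f t) x ^ 2 ≤ m ^ 2 + ε * t := by
    intro ε hε
    obtain ⟨⟨s, y⟩, ⟨hs, -⟩, hmax⟩ := (isCompact_Icc.prod isCompact_univ).exists_isMaxOn
      ⟨(t, x), ⟨⟨ht0, le_rfl⟩, trivial⟩⟩
      (hc.sub ((continuousOn_const (c := ε)).mul continuousOn_fst))
    have hle : ∀ s' ∈ Icc 0 t, ∀ y', lam 𝓗 ρ (f s') y' ^ 2 - ε * s'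
        ≤ lam 𝓗 ρ (f s) y ^ 2 - ε * s := fun s' hs' y' => hmax (a := (s', y')) ⟨hs', trivial⟩
    have hs0 : s = 0 := by
      by_contra hne
      have hspos : 0 < s := lt_of_le_of_ne hs.1 (Ne.symm hne)
      obtain ⟨T, U, h⟩ := exists_isFlowChart hτ hτ' hf (hsub hs) y
      have hlap := h.laplacian_nonpos hf fun y' => by linarith [hle s hs y']
      have hd := ((hf.hasDerivWithinAt_lam_sq hτ hτ' (hsub hs) (x₀ := y)).mono
        ((Icc_subset_Icc_right hs.2).trans hsub)).sub
        ((hasDerivWithinAt_id s (Icc 0 s)).const_mul ε)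
      have hlm : IsLocalMaxOn (fun s' => lam 𝓗 ρ (f s') y ^ 2 - ε * id s') (Icc 0 s) s := by
        filter_upwards [self_mem_nhdsWithin] with s' hs'
        exact hle s' ⟨hs'.1, hs'.2.trans hs.2⟩ y
      -- Only the backward direction is used, as `s` may be the final time `t`. Maximality makes the
      -- time derivative at `s` nonnegative, but the evolution law makes it at most `-ε`.
      have hcone : (0 : ℝ) - s ∈ posTangentConeAt (Icc 0 s) s :=
        sub_mem_posTangentConeAt_of_segment_subset
          (by rw [segment_symm, segment_eq_Icc hspos.le])
      have h1 := hlm.hasFDerivWithinAt_nonpos hd.hasFDerivWithinAt hcone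
      simp only [ContinuousLinearMap.toSpanSingleton_apply, smul_eq_mul, mul_one] at h1
      have h2 := mul_nonpos_of_nonneg_of_nonpos (sq_nonneg (lam 𝓗 ρ (f s) y)) hlap
      have h3 := mul_nonneg (sq_nonneg (lam 𝓗 ρ (f s) y ^ 2)) (meanCurvSq_nonneg 𝓗 (f s) y)
      nlinarith
    have h4 := hle t ⟨ht0, le_rfl⟩ x
    have h5 := pow_le_pow_left₀ (lam_nonneg 𝓗 ρ (f 0) y) (hm' y) 2
    rw [hs0] at h4
    linarith
  refine le_of_sq_le_sq ?_ hm0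
  refine le_of_forall_pos_le_add fun δ hδ => ?_
  -- The denominator is `t + 1` because `t` may be `0`; this choice makes `ε t ≤ δ`.
  have h6 := key (δ / (t + 1)) (by positivity)
  have h7 : δ / (t + 1) * t ≤ δ := by
    rw [div_mul_eq_mul_div, div_le_iff₀ (by positivity)]
    nlinarith
  linarith

end Flow

end HFlow

end

theorem proposition2p3
    {S M : Type*} [TopologicalSpace S] [T2Space S] [ChartedSpace (HFlow.Euc 2) S]
    [IsManifold (𝓡 2) ∞ S]
    [TopologicalSpace M] [T2Space M] [ChartedSpace (HFlow.Euc 4) M] [IsManifold (𝓡 4) ∞ M]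
    (𝓗 : HFlow.HyperKahler M) (ρ : HFlow.AreaForm S)
    (τ : Set ℝ) (hτ : τ.OrdConnected) (hτ' : τ.Nontrivial) (h0 : IsLeast τ 0)
    (f : ℝ → S → M) (hf : HFlow.IsHFlow 𝓗 ρ τ f) :
    -- evolution of the metric, area form and `λ²`
    (∀ t ∈ τ, ∀ x : S,
      (∀ (X Y : TangentSpace (𝓡 2) x) (e : Fin 2 → TangentSpace (𝓡 4) (f t x)),
        HFlow.IsNormalFrame 𝓗 (f t) x e →
        HasDerivWithinAt (fun s => HFlow.inducedMetric 𝓗 (f s) x X Y)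
          (HFlow.hess (HFlow.inducedMetric 𝓗 (f t)) (fun y => HFlow.lam 𝓗 ρ (f t) y ^ 2) x X Y
            - 2 * HFlow.lam 𝓗 ρ (f t) x ^ 2 *
              ∑ α, 𝓗.metric.inner (f t x) (e α) (HFlow.meanCurv 𝓗 (f t) x) *
                𝓗.metric.inner (f t x) (e α) (HFlow.secondFF 𝓗 (f t) x X Y))
          τ t) ∧
      (∀ X Y : TangentSpace (𝓡 2) x,
        HasDerivWithinAt (fun s => HFlow.inducedArea 𝓗 ρ (f s) x X Y)
          ((HFlow.laplacian (HFlow.inducedMetric 𝓗 (f t))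
              (fun y => HFlow.lam 𝓗 ρ (f t) y ^ 2 / 2) x
            - HFlow.lam 𝓗 ρ (f t) x ^ 2 * HFlow.meanCurvSq 𝓗 (f t) x)
            * HFlow.inducedArea 𝓗 ρ (f t) x X Y)
          τ t) ∧
      HasDerivWithinAt (fun s => HFlow.lam 𝓗 ρ (f s) x ^ 2)
        (HFlow.lam 𝓗 ρ (f t) x ^ 2 *
            HFlow.laplacian (HFlow.inducedMetric 𝓗 (f t)) (fun y => HFlow.lam 𝓗 ρ (f t) y ^ 2) x
          - 2 * (HFlow.lam 𝓗 ρ (f t) x ^ 2) ^ 2 * HFlow.meanCurvSq 𝓗 (f t) x)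
        τ t) ∧
    -- the maximum principle bound
    (CompactSpace S → ∀ t ∈ τ, ∀ x : S,
      HFlow.lam 𝓗 ρ (f t) x ≤ ⨆ y : S, HFlow.lam 𝓗 ρ (f 0) y) := by
  refine ⟨fun t ht x => ⟨fun X Y e he => hf.hasDerivWithinAt_metric hτ hτ' ht X Y e he,
    hf.hasDerivWithinAt_area hτ hτ' ht, hf.hasDerivWithinAt_lam_sq hτ hτ' ht⟩, ?_⟩
  intro hS t ht x
  exact hf.lam_le_iSup hτ hτ' h0 ht x
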